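/- **Operators.** For $k\ge 0$ let $\mathcal S_k=\mathcal S(\mathbb R,\mathbb R^k)$ be the space of rapidly decreasing functions of $l$, $D=d/dl$, and $D^{-1}g(l)=\frac12\big(\int_{-\infty}^l g-\int_l^\infty g\big)$, the antiderivative whose limits at $\pm\infty$ add up to zero. Write $v\wedge f=v\otimes f-f\otimes v$, i.e. $(v\wedge f)_{ij}=v_if_j-f_iv_j$, and $(v\rfloor B)_j=\sum_i v_iB_{ij}$. For a point $v$ put $$\mathcal J_v f=Df+D^{-1}(v\cdot f)\,v,\qquad \mathcal H_v f=Df+v\rfloor D^{-1}(v\wedge f),\qquad \mathfrak R_v=\mathcal H_v\circ\mathcal J_v .$$ Let $n,m\ge1$. Denote by $h\mathcal J,h\mathcal H,h\mathfrak R$ these operators for $k=n-1$ and variable $v=\vec v$, by $v\mathcal J,v\mathcal H,v\mathfrak R$ those for $k=m-1$ and variable $v=\overleftarrow v$. **Geometry.** Let $V$ be a smooth manifold with coordinates $u=(x^i,y^a)\in\mathbb R^n\times\mathbb R^m$ adapted to a vertical distribution $\langle\partial/\partial y^a\rangle$ (for instance, the total space of a vector bundle), with an N-connection $N_i^a(u)$,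 coframe $e^i=dx^i$, $e^a=dy^a+N^a_idx^i$, a positive definite d-metric $g_{ij}e^i\otimes e^j+h_{ab}e^a\otimes e^b$, and a metric-compatible d-connection $\mathbf D$ (for instance the canonical one), all smooth. Let $T\subset\mathbb R$ be open and $\gamma(\tau,l)\in V$, $\tau\in T$, $l\in\mathbb R$, a smooth flow of curves, with $X=\gamma_l$, $Y=\gamma_\tau$; $\mathbf D_X$, $\mathbf D_Y$ are the covariant derivatives along $\gamma$ in the $l$- and $\tau$-direction. For the h-flow assume: $|hX|=1$; $hT(X,Y)=0$ for the h-part $T^i=de^i+\Gamma^i_j\wedge e^j$ of the torsion; and $R(X,Y)Z=\vec R\,\big(g(hY,Z)hX-g(hX,Z)hY\big)$ for horizontal $Z$ along $\gamma$, with a constant $\vec R$ ($\vec R=1$ for the unit sphere). Let $e_1=hX,e_2,\dots,e_n$ be a smooth orthonormal frame of the horizontal bundle along $\gamma$ with $\mathbf D_Xe_i\parallel e_1$ for $i\ge2$. Fix a sign $\sigma\in\{1,-1\}$, and define $\vec v,\vec\varpi,h\vec e_\perp\in\mathbb R^{n-1}$, $he_\parallel\in\mathbb R$ and the skew matrix $h\Theta$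 by $$\mathbf D_Xe_1=\sigma\sum_{i\ge2}v_ie_i,\quad \mathbf D_Ye_1=\sigma\sum_{i\ge2}\varpi_ie_i,\quad hY=he_\parallel e_1+\sum_{i\ge2}(he_\perp)_ie_i,\quad h\Theta_{ij}=g(\mathbf D_Ye_i,e_j).$$ Suppose that, for every $\tau$, $\vec v\cdot h\vec e_\perp$ and the entries of $\vec v\wedge\vec\varpi$ are integrable in $l$, and that the constants of integration are fixed by $he_\parallel(\tau,l)+he_\parallel(\tau,-l)\to0$ and $h\Theta(\tau,l)+h\Theta(\tau,-l)\to0$ as $l\to\infty$. For the v-flow make the same assumptions and definitions with the vertical bundle, $n\to m$, $g\to h$, $T^a=de^a+\Gamma^a_b\wedge e^b$, curvature constant $\overleftarrow S$, and variables $\overleftarrow v,\overleftarrow\varpi,v\overleftarrow e_\perp$. **Theorem.** (1) $h\mathcal J$ and $v\mathcal J$ are symplectic operators, invariant under $O(n-1)$ and $O(m-1)$, respectively ($\mathcal J_{Qv}Q=Q\mathcal J_v$): $\mathcal J_v$ is linear on $\mathcal S_k$, and $\omega_v(f,g)=\int f\cdot\mathcal J_vg\,dl$ is a closed $2$-form on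 $\mathcal S_k$. (2) $h\mathcal H$ and $v\mathcal H$ are Hamiltonian (cosymplectic) operators, invariant under $O(n-1)$ and $O(m-1)$, respectively: $\mathcal H_v$ is linear and skew-adjoint on $\mathcal S_k$ and satisfies the Jacobi identity: with $P_v(\xi,\eta)=\int\xi\cdot\mathcal H_v\eta\,dl$ and $P'_v[w]$ its derivative in the direction $w$ of the variable $v$, $P'_v[\mathcal H_v\zeta](\xi,\eta)+P'_v[\mathcal H_v\xi](\eta,\zeta)+P'_v[\mathcal H_v\eta](\zeta,\xi)=0$ for all $v,\xi,\eta,\zeta\in\mathcal S_k$ such that the entries of $v\wedge\xi$, $v\wedge\eta$, $v\wedge\zeta$ are derivatives of rapidly decreasing functions. (3) The recursion operators $h\mathfrak R=h\mathcal H\circ h\mathcal J$ and $v\mathfrak R=v\mathcal H\circ v\mathcal J$ are hereditary: $\mathfrak R'_v[\mathfrak R_vf]g-\mathfrak R'_v[\mathfrak R_vg]f-\mathfrak R_v\big(\mathfrak R'_v[f]g-\mathfrak R'_v[g]f\big)=0$ for all $v,f,g\in\mathcal S_k$ such that the entries of $v\wedge\mathcal J_vf$, $v\wedge\mathcal J_vg$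 are derivatives of rapidly decreasing functions. (4) The h-flows and the v-flows have the Hamiltonian form $$\vec\varpi=\sigma\,h\mathcal J(h\vec e_\perp),\qquad \vec v_\tau=h\mathcal H(\vec\varpi)+\sigma\vec R\,h\vec e_\perp=\sigma\big(h\mathfrak R(h\vec e_\perp)+\vec R\,h\vec e_\perp\big),$$ $$\overleftarrow\varpi=\sigma\,v\mathcal J(v\overleftarrow e_\perp),\qquad \overleftarrow v_\tau=v\mathcal H(\overleftarrow\varpi)+\sigma\overleftarrow S\,v\overleftarrow e_\perp=\sigma\big(v\mathfrak R(v\overleftarrow e_\perp)+\overleftarrow S\,v\overleftarrow e_\perp\big).$$ For $\sigma=-1$ this reads $\vec v_\tau=h\mathcal H(\vec\varpi)-\vec R\,h\vec e_\perp$ with $\vec\varpi=-h\mathcal J(h\vec e_\perp)$; for $\sigma=1$, where $\vec v,\vec\varpi$ are the principal normals, $\vec v_\tau=h\mathcal H(\vec\varpi)+\vec R\,h\vec e_\perp$ with $\vec\varpi=h\mathcal J(h\vec e_\perp)$. -/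

import Mathlib

open MeasureTheory Filter Topology Set
open scoped Manifold ContDiff SchwartzMap

noncomputable section

/-- `ℝᵏ` with its Euclidean inner product. -/
abbrev EV (k : ℕ) : Type := EuclideanSpace ℝ (Fin k)

/-! ## The operators -/

/-- The inverse `D⁻¹` of `D = d/dl`: the antiderivative whose limits at `-∞` and `+∞` add up to
zero.  If `g = G'` with `G` rapidly decreasing, then `D⁻¹ g = G`. -/
def Dinv (g : ℝ → ℝ) (x : ℝ) : ℝ :=
  (1 / 2) * ((∫ y in Iic x, g y) - ∫ y in Ioi x, g y)

/-- `v ∧ f = v ⊗ f - f ⊗ v`, entrywise: `(v ∧ f)ᵢⱼ = vᵢ fⱼ - fᵢ vⱼ`. -/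
def wedge {k : ℕ} (v f : ℝ → EV k) (i j : Fin k) (x : ℝ) : ℝ :=
  v x i * f x j - f x i * v x j

/-- `J f = D f + D⁻¹(v · f) v`. -/
def opJ {k : ℕ} (v f : ℝ → EV k) (x : ℝ) : EV k :=
  deriv f x + Dinv (fun y => inner ℝ (v y) (f y)) x • v x

/-- `H f = D f + v ⌋ D⁻¹(v ∧ f)`, where `(v ⌋ B)ⱼ = ∑ᵢ vᵢ Bᵢⱼ`. -/
def opH {k : ℕ} (v f : ℝ → EV k) (x : ℝ) : EV k :=
  deriv f x + WithLp.toLp 2 (fun j => ∑ i, v x i * Dinv (wedge v f i j) x)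

/-- The recursion operator `H ∘ J`. -/
def opR {k : ℕ} (v f : ℝ → EV k) : ℝ → EV k :=
  opH v (opJ v f)

/-- A family of operators `f ↦ A v f`, depending on the point `v` of the phase space. -/
abbrev OpFamily (k : ℕ) : Type := (ℝ → EV k) → (ℝ → EV k) → ℝ → EV k

/-- For each `v` in the phase space `𝓢(ℝ, ℝᵏ)` of rapidly decreasing functions, `A v` is a linear
operator on `𝓢(ℝ, ℝᵏ)`. -/
structure IsLinearFamily {k : ℕ} (A : OpFamily k) : Prop where
  maps : ∀ v f : 𝓢(ℝ, EV k), ∃ g : 𝓢(ℝ, EV k), ⇑g = A v f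
  add : ∀ v f g : 𝓢(ℝ, EV k), A v ⇑(f + g) = A v f + A v g
  smul : ∀ (c : ℝ) (v f : 𝓢(ℝ, EV k)), A v ⇑(c • f) = c • A v f

/-- Invariance under the orthogonal group `O(k)`: `A_{Qv}(Q f) = Q (A_v f)`. -/
def IsOrthInvariant {k : ℕ} (A : OpFamily k) : Prop :=
  ∀ (Q : EV k ≃ₗᵢ[ℝ] EV k) (v f : 𝓢(ℝ, EV k)) (x : ℝ),
    A (fun y => Q (v y)) (fun y => Q (f y)) x = Q (A v f x)

/-- The bilinear form `(f, g) ↦ ∫ f · (A v g) dl`. -/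
def opForm {k : ℕ} (A : OpFamily k) (v f g : ℝ → EV k) : ℝ :=
  ∫ x, inner ℝ (f x) (A v g x)

/-- Derivative of `v ↦ opForm A v f g` in the direction `h`. -/
def opFormDeriv {k : ℕ} (A : OpFamily k) (v h f g : ℝ → EV k) : ℝ :=
  deriv (fun t : ℝ => opForm A (v + t • h) f g) 0

/-- `A` is a symplectic operator: `ω_v(f, g) = ∫ f · (A v g) dl` is a closed `2`-form on the phase
space. -/
structure IsSymplecticOperator {k : ℕ} (A : OpFamily k) : Prop where
  linear : IsLinearFamily A
  skew : ∀ v f g : 𝓢(ℝ, EV k), opForm A v f g = -opForm A v g f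
  differentiable : ∀ v h f g : 𝓢(ℝ, EV k),
    DifferentiableAt ℝ (fun t : ℝ => opForm A (⇑v + t • ⇑h) f g) 0
  closed : ∀ v f g h : 𝓢(ℝ, EV k),
    opFormDeriv A v h f g + opFormDeriv A v f g h + opFormDeriv A v g h f = 0

/-- `A` is a Hamiltonian (cosymplectic) operator: `{F, G} = ∫ δF · (A δG) dl` is skew and satisfies
the Jacobi identity, i.e. the Schouten bracket `[A, A]_v(ξ, η, ζ)` vanishes.  `adm v` is the set of
covectors at `v` on which the nonlocal terms of `A v` are defined. -/
structure IsHamiltonianOperator {k : ℕ} (A : OpFamily k)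
    (adm : (ℝ → EV k) → (ℝ → EV k) → Prop) : Prop where
  linear : IsLinearFamily A
  skew : ∀ v f g : 𝓢(ℝ, EV k), opForm A v f g = -opForm A v g f
  differentiable : ∀ v f g ζ : 𝓢(ℝ, EV k),
    DifferentiableAt ℝ (fun t : ℝ => opForm A (⇑v + t • A v ζ) f g) 0
  jacobi : ∀ v ξ η ζ : 𝓢(ℝ, EV k), adm v ξ → adm v η → adm v ζ →
    opFormDeriv A v (A v ζ) ξ η + opFormDeriv A v (A v ξ) η ζ
      + opFormDeriv A v (A v η) ζ ξ = 0

/-- All entries of `v ∧ f` lie in the range of `D` on rapidly decreasing functions, so that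
`D⁻¹(v ∧ f)` involves no constant of integration. -/
def WedgeExact {k : ℕ} (v f : ℝ → EV k) : Prop :=
  ∀ i j, ∃ B : 𝓢(ℝ, ℝ), ∀ x, deriv B x = wedge v f i j x

/-- Pointwise derivative of `v ↦ A v f` in the direction `h`. -/
def opDeriv {k : ℕ} (A : OpFamily k) (v h f : ℝ → EV k) (x : ℝ) : EV k :=
  deriv (fun t : ℝ => A (v + t • h) f x) 0

/-- `A` is hereditary: its Nijenhuis torsion
`A'[A f] g - A'[A g] f - A (A'[f] g - A'[g] f)` vanishes, for `f, g` admissible at `v`. -/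
structure IsHereditary {k : ℕ} (A : OpFamily k)
    (adm : (ℝ → EV k) → (ℝ → EV k) → Prop) : Prop where
  linear : IsLinearFamily A
  differentiable : ∀ (v h f : 𝓢(ℝ, EV k)) (x : ℝ),
    DifferentiableAt ℝ (fun t : ℝ => A (⇑v + t • ⇑h) f x) 0
  torsion_eq_zero : ∀ v f g : 𝓢(ℝ, EV k), adm v f → adm v g → ∀ x,
    opDeriv A v (A v f) g x - opDeriv A v (A v g) f x
      - A v (fun y => opDeriv A v f g y - opDeriv A v g f y) x = 0

/-! ## N-anholonomic manifolds, d-metrics and d-connections, in adapted coordinates `u = (x, y)` -/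

/-- Coordinates `u = (x, y)`, `x ∈ ℝⁿ`, `y ∈ ℝᵐ`. -/
abbrev UV (n m : ℕ) : Type := EV n × EV m

/-- Coordinate systems on `V`. -/
abbrev Chart (n m : ℕ) (V : Type*) [TopologicalSpace V] : Type _ :=
  OpenPartialHomeomorph V (UV n m)

/-- An N-anholonomic manifold with d-metric.  The charts are adapted to the vertical distribution
spanned by the `∂/∂yᵃ` (for a vector bundle: coordinates of a local trivialisation).  In each chart
there are given the coefficients `N = (Nᵃᵢ)` of the N-connection, whose horizontal vectors at `u` are
the `(X, -N X)`, and the blocks `g = (g_ij)` and `h = (h_ab)` of the d-metric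
`g_ij eⁱ ⊗ eʲ + h_ab eᵃ ⊗ eᵇ`, where `eⁱ = dxⁱ`, `eᵃ = dyᵃ + Nᵃᵢ dxⁱ`. -/
structure NManifold (n m : ℕ) (V : Type*) [TopologicalSpace V] [ChartedSpace (UV n m) V] where
  fibred : ∀ c ∈ atlas (UV n m) V, ∀ c' ∈ atlas (UV n m) V, ∀ u ∈ (c.symm ≫ₕ c').source,
    ∀ B : EV m, (fderiv ℝ (c.symm ≫ₕ c') u (0, B)).1 = 0
  N : Chart n m V → UV n m → EV n →L[ℝ] EV m
  g : Chart n m V → UV n m → EV n →L[ℝ] EV n →L[ℝ] ℝ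
  h : Chart n m V → UV n m → EV m →L[ℝ] EV m →L[ℝ] ℝ
  N_smooth : ∀ c ∈ atlas (UV n m) V, ContDiffOn ℝ ∞ (N c) c.target
  g_smooth : ∀ c ∈ atlas (UV n m) V, ContDiffOn ℝ ∞ (g c) c.target
  h_smooth : ∀ c ∈ atlas (UV n m) V, ContDiffOn ℝ ∞ (h c) c.target
  g_symm : ∀ c ∈ atlas (UV n m) V, ∀ u ∈ c.target, ∀ X Y, g c u X Y = g c u Y X
  h_symm : ∀ c ∈ atlas (UV n m) V, ∀ u ∈ c.target, ∀ X Y, h c u X Y = h c u Y X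
  g_pos : ∀ c ∈ atlas (UV n m) V, ∀ u ∈ c.target, ∀ X, X ≠ 0 → 0 < g c u X X
  h_pos : ∀ c ∈ atlas (UV n m) V, ∀ u ∈ c.target, ∀ X, X ≠ 0 → 0 < h c u X X
  N_trans : ∀ c ∈ atlas (UV n m) V, ∀ c' ∈ atlas (UV n m) V, ∀ u ∈ (c.symm ≫ₕ c').source,
    ∀ X : EV n, (fderiv ℝ (c.symm ≫ₕ c') u (X, -N c u X)).2
      = -N c' ((c.symm ≫ₕ c') u) (fderiv ℝ (c.symm ≫ₕ c') u (X, -N c u X)).1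
  g_trans : ∀ c ∈ atlas (UV n m) V, ∀ c' ∈ atlas (UV n m) V, ∀ u ∈ (c.symm ≫ₕ c').source,
    ∀ X Y : EV n, g c u X Y = g c' ((c.symm ≫ₕ c') u)
      (fderiv ℝ (c.symm ≫ₕ c') u (X, 0)).1 (fderiv ℝ (c.symm ≫ₕ c') u (Y, 0)).1
  h_trans : ∀ c ∈ atlas (UV n m) V, ∀ c' ∈ atlas (UV n m) V, ∀ u ∈ (c.symm ≫ₕ c').source,
    ∀ A B : EV m, h c u A B = h c' ((c.symm ≫ₕ c') u)
      (fderiv ℝ (c.symm ≫ₕ c') u (0, A)).2 (fderiv ℝ (c.symm ≫ₕ c') u (0, B)).2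

variable {n m : ℕ} {V : Type*} [TopologicalSpace V] [ChartedSpace (UV n m) V]

/-- A metric d-connection, given by its matrix-valued connection 1-forms on the horizontal and the
vertical subbundle with respect to the N-adapted frames: in terms of the coefficients
`L^i_jk, C^i_jc, L^a_bk, C^a_bc`, `Γh` has the entries `L^i_jk e^k + C^i_jc e^c` and `Γv` the entries
`L^a_bk e^k + C^a_bc e^c`.  The laws are smoothness, the transformation rules of connection forms,
and the metric compatibility `D g = 0`, `D h = 0`.  The canonical d-connection is one of these. -/
structure MetricDConnection (M : NManifold n m V) where
  Γh : Chart n m V → UV n m → UV n m →L[ℝ] EV n →L[ℝ] EV n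
  Γv : Chart n m V → UV n m → UV n m →L[ℝ] EV m →L[ℝ] EV m
  Γh_smooth : ∀ c ∈ atlas (UV n m) V, ContDiffOn ℝ ∞ (Γh c) c.target
  Γv_smooth : ∀ c ∈ atlas (UV n m) V, ContDiffOn ℝ ∞ (Γv c) c.target
  Γh_trans : ∀ c ∈ atlas (UV n m) V, ∀ c' ∈ atlas (UV n m) V, ∀ u ∈ (c.symm ≫ₕ c').source,
    ∀ (w : UV n m) (Z : EV n),
      Γh c' ((c.symm ≫ₕ c') u) (fderiv ℝ (c.symm ≫ₕ c') u w) (fderiv ℝ (c.symm ≫ₕ c') u (Z, 0)).1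
        = (fderiv ℝ (c.symm ≫ₕ c') u (Γh c u w Z, 0)).1
          - fderiv ℝ (fun u' => (fderiv ℝ (c.symm ≫ₕ c') u' (Z, 0)).1) u w
  Γv_trans : ∀ c ∈ atlas (UV n m) V, ∀ c' ∈ atlas (UV n m) V, ∀ u ∈ (c.symm ≫ₕ c').source,
    ∀ (w : UV n m) (Z : EV m),
      Γv c' ((c.symm ≫ₕ c') u) (fderiv ℝ (c.symm ≫ₕ c') u w) (fderiv ℝ (c.symm ≫ₕ c') u (0, Z)).2
        = (fderiv ℝ (c.symm ≫ₕ c') u (0, Γv c u w Z)).2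
          - fderiv ℝ (fun u' => (fderiv ℝ (c.symm ≫ₕ c') u' (0, Z)).2) u w
  Dg : ∀ c ∈ atlas (UV n m) V, ∀ u ∈ c.target, ∀ (w : UV n m) (Y Z : EV n),
    fderiv ℝ (fun u' => M.g c u' Y Z) u w = M.g c u (Γh c u w Y) Z + M.g c u Y (Γh c u w Z)
  Dh : ∀ c ∈ atlas (UV n m) V, ∀ u ∈ c.target, ∀ (w : UV n m) (Y Z : EV m),
    fderiv ℝ (fun u' => M.h c u' Y Z) u w = M.h c u (Γv c u w Y) Z + M.h c u Y (Γv c u w Z)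

/-- What the horizontal and the vertical part of the geometry have in common, with `r = n` and
`r = m`, respectively: the subbundle (`mem`), the `ℝʳ`-valued coframe, which also projects tangent
vectors to their components in the subbundle, the fibre metric and the connection form. -/
structure DPart (n m r : ℕ) (V : Type*) [TopologicalSpace V] where
  mem : Chart n m V → UV n m → UV n m → Prop
  coframe : Chart n m V → UV n m → UV n m →L[ℝ] EV r
  metric : Chart n m V → UV n m → EV r →L[ℝ] EV r →L[ℝ] ℝ
  conn : Chart n m V → UV n m → UV n m →L[ℝ] EV r →L[ℝ] EV r

/-- The horizontal part: coframe `eⁱ = dxⁱ`, metric `g_ij`, connection form `Γh`. -/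
def hPart {M : NManifold n m V} (D : MetricDConnection M) : DPart n m n V where
  mem c u w := w.2 + M.N c u w.1 = 0
  coframe _ _ := ContinuousLinearMap.fst ℝ (EV n) (EV m)
  metric := M.g
  conn := D.Γh

/-- The vertical part: coframe `eᵃ = dyᵃ + Nᵃᵢ dxⁱ`, metric `h_ab`, connection form `Γv`. -/
def vPart {M : NManifold n m V} (D : MetricDConnection M) : DPart n m m V where
  mem _ _ w := w.1 = 0
  coframe c u := ContinuousLinearMap.snd ℝ (EV n) (EV m)
    + (M.N c u).comp (ContinuousLinearMap.fst ℝ (EV n) (EV m))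
  metric := M.h
  conn := D.Γv

variable {r p : ℕ}

/-- The torsion form `T = de + Γ ∧ e`, evaluated on `X, Y`. -/
def DPart.torsion (P : DPart n m r V) (c : Chart n m V) (u X Y : UV n m) : EV r :=
  fderiv ℝ (P.coframe c) u X Y - fderiv ℝ (P.coframe c) u Y X
    + P.conn c u X (P.coframe c u Y) - P.conn c u Y (P.coframe c u X)

/-- The curvature `R(X, Y) Z = (dΓ + Γ ∧ Γ)(X, Y) Z`. -/
def DPart.curvature (P : DPart n m r V) (c : Chart n m V) (u X Y : UV n m) (Z : EV r) : EV r :=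
  fderiv ℝ (P.conn c) u X Y Z - fderiv ℝ (P.conn c) u Y X Z
    + P.conn c u X (P.conn c u Y Z) - P.conn c u Y (P.conn c u X Z)

/-! ## Curve flows -/

/-- Covariant derivative, in the direction `w` of the parameter plane, of a field `Z` of components
along the flow `γ(τ, l)`. -/
def DPart.covDeriv (P : DPart n m r V) (γ : ℝ × ℝ → V) (c : Chart n m V) (Z : ℝ × ℝ → EV r)
    (s w : ℝ × ℝ) : EV r :=
  fderiv ℝ Z s w + P.conn c (c (γ s)) (fderiv ℝ (c ∘ γ) s w) (Z s)

/-- Component in the subbundle, in the chart `c`, of the velocity of `γ` in the parameter direction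
`w`; `w = (0, 1)` gives `X = γ_l` and `w = (1, 0)` gives `Y = γ_τ`. -/
def DPart.vel (P : DPart n m r V) (γ : ℝ × ℝ → V) (c : Chart n m V) (s w : ℝ × ℝ) : EV r :=
  P.coframe c (c (γ s)) (fderiv ℝ (c ∘ γ) s w)

/-- Coordinates in the chart `c` of a tangent vector at `x`. -/
def tcoord (c : Chart n m V) (x : V) (ξ : TangentSpace 𝓘(ℝ, UV n m) x) : UV n m :=
  mfderiv 𝓘(ℝ, UV n m) 𝓘(ℝ, UV n m) c x ξ

/-- Components, with respect to the coframe, of the frame vector `e a` along `γ`. -/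
def DPart.frame (P : DPart n m r V) (γ : ℝ × ℝ → V)
    (e : Fin r → (s : ℝ × ℝ) → TangentSpace 𝓘(ℝ, UV n m) (γ s)) (c : Chart n m V) (a : Fin r)
    (s : ℝ × ℝ) : EV r :=
  P.coframe c (c (γ s)) (tcoord c (γ s) (e a s))

/-- `γ(τ, l)`, `τ ∈ T`, `l ∈ ℝ`, is a smooth curve flow, and `e 0, …, e p` is a smooth orthonormal
frame of the subbundle along `γ` which is adapted to the flow: `e 0` is the component of `X = γ_l` in
the subbundle (in particular, this component has unit length), and the `e i`, `i ≥ 1`, are parallel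
in the normal bundle, i.e. `D_X (e i)` is tangential. -/
structure IsAdaptedFlow (P : DPart n m (p + 1) V) (T : Set ℝ) (γ : ℝ × ℝ → V)
    (e : Fin (p + 1) → (s : ℝ × ℝ) → TangentSpace 𝓘(ℝ, UV n m) (γ s)) : Prop where
  flow_smooth : ContMDiffOn 𝓘(ℝ, ℝ × ℝ) 𝓘(ℝ, UV n m) ∞ γ (T ×ˢ univ)
  frame_smooth : ∀ c ∈ atlas (UV n m) V, ∀ a,
    ContDiffOn ℝ ∞ (P.frame γ e c a) ((T ×ˢ univ) ∩ γ ⁻¹' c.source)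
  frame_mem : ∀ c ∈ atlas (UV n m) V, ∀ s, s.1 ∈ T → γ s ∈ c.source → ∀ a,
    P.mem c (c (γ s)) (tcoord c (γ s) (e a s))
  orthonormal : ∀ c ∈ atlas (UV n m) V, ∀ s, s.1 ∈ T → γ s ∈ c.source → ∀ a b,
    P.metric c (c (γ s)) (P.frame γ e c a s) (P.frame γ e c b s) = if a = b then 1 else 0
  tangent : ∀ c ∈ atlas (UV n m) V, ∀ s, s.1 ∈ T → γ s ∈ c.source →
    P.frame γ e c 0 s = P.vel γ c s (0, 1)
  parallel : ∀ c ∈ atlas (UV n m) V, ∀ s, s.1 ∈ T → γ s ∈ c.source → ∀ i j : Fin p,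
    P.metric c (c (γ s)) (P.covDeriv γ c (P.frame γ e c i.succ) s (0, 1))
      (P.frame γ e c j.succ s) = 0

/-- The variables of a curve flow, as functions of `τ` and `l`. -/
structure FlowVars (p : ℕ) where
  v : ℝ → ℝ → EV p
  varpi : ℝ → ℝ → EV p
  ePerp : ℝ → ℝ → EV p
  ePar : ℝ → ℝ → ℝ
  Theta : ℝ → ℝ → Fin p → Fin p → ℝ

/-- `W` consists of the variables of the flow `γ`, computed in the adapted frame `e`:
`Y = ePar e₀ + ∑ ePerpᵢ eᵢ` (components in the subbundle), `D_X e₀ = σ ∑ vᵢ eᵢ`,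
`D_Y e₀ = σ ∑ ϖᵢ eᵢ`, `Θᵢⱼ = ⟨D_Y eᵢ, eⱼ⟩`.  The sign `σ` is the sign convention for reading the
connection matrices: `σ = 1` makes `v`, `ϖ` the principal normals. -/
structure IsFlowVars (P : DPart n m (p + 1) V) (T : Set ℝ) (γ : ℝ × ℝ → V)
    (e : Fin (p + 1) → (s : ℝ × ℝ) → TangentSpace 𝓘(ℝ, UV n m) (γ s)) (σ : ℝ)
    (W : FlowVars p) : Prop where
  v_eq : ∀ c ∈ atlas (UV n m) V, ∀ τ ∈ T, ∀ l, γ (τ, l) ∈ c.source → ∀ i,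
    W.v τ l i = σ * P.metric c (c (γ (τ, l)))
      (P.covDeriv γ c (P.frame γ e c 0) (τ, l) (0, 1)) (P.frame γ e c i.succ (τ, l))
  varpi_eq : ∀ c ∈ atlas (UV n m) V, ∀ τ ∈ T, ∀ l, γ (τ, l) ∈ c.source → ∀ i,
    W.varpi τ l i = σ * P.metric c (c (γ (τ, l)))
      (P.covDeriv γ c (P.frame γ e c 0) (τ, l) (1, 0)) (P.frame γ e c i.succ (τ, l))
  ePerp_eq : ∀ c ∈ atlas (UV n m) V, ∀ τ ∈ T, ∀ l, γ (τ, l) ∈ c.source → ∀ i,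
    W.ePerp τ l i = P.metric c (c (γ (τ, l)))
      (P.vel γ c (τ, l) (1, 0)) (P.frame γ e c i.succ (τ, l))
  ePar_eq : ∀ c ∈ atlas (UV n m) V, ∀ τ ∈ T, ∀ l, γ (τ, l) ∈ c.source →
    W.ePar τ l = P.metric c (c (γ (τ, l)))
      (P.vel γ c (τ, l) (1, 0)) (P.frame γ e c 0 (τ, l))
  Theta_eq : ∀ c ∈ atlas (UV n m) V, ∀ τ ∈ T, ∀ l, γ (τ, l) ∈ c.source → ∀ i j,
    W.Theta τ l i j = P.metric c (c (γ (τ, l)))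
      (P.covDeriv γ c (P.frame γ e c i.succ) (τ, l) (1, 0)) (P.frame γ e c j.succ (τ, l))

/-- The torsion of the considered part of the d-connection vanishes along the flow: `T(X, Y) = 0`. -/
def TorsionFreeAlong (P : DPart n m r V) (T : Set ℝ) (γ : ℝ × ℝ → V) : Prop :=
  ∀ c ∈ atlas (UV n m) V, ∀ s, s.1 ∈ T → γ s ∈ c.source →
    P.torsion c (c (γ s)) (fderiv ℝ (c ∘ γ) s (0, 1)) (fderiv ℝ (c ∘ γ) s (1, 0)) = 0

/-- The d-connection has constant curvature `R` along the flow: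
`R(X, Y) Z = R (⟨Y, Z⟩ X - ⟨X, Z⟩ Y)`, with `R = 1` for the unit sphere. -/
def ConstCurvatureAlong (P : DPart n m r V) (T : Set ℝ) (γ : ℝ × ℝ → V) (R : ℝ) : Prop :=
  ∀ c ∈ atlas (UV n m) V, ∀ s, s.1 ∈ T → γ s ∈ c.source → ∀ Z : EV r,
    P.curvature c (c (γ s)) (fderiv ℝ (c ∘ γ) s (0, 1)) (fderiv ℝ (c ∘ γ) s (1, 0)) Z
      = R • (P.metric c (c (γ s)) (P.vel γ c s (1, 0)) Z • P.vel γ c s (0, 1)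
          - P.metric c (c (γ s)) (P.vel γ c s (0, 1)) Z • P.vel γ c s (1, 0))

/-- The nonlocal expressions make sense, and the constants of integration (depending on `τ`) in
`ePar` and `Θ` are those chosen by `D⁻¹`: the limits at `l = ±∞` add up to zero. -/
structure IsNormalized (T : Set ℝ) (W : FlowVars p) : Prop where
  integrable_dot : ∀ τ ∈ T, Integrable (fun l => (inner ℝ (W.v τ l) (W.ePerp τ l) : ℝ))
  integrable_wedge : ∀ τ ∈ T, ∀ i j, Integrable (wedge (W.v τ) (W.varpi τ) i j)
  ePar_limits : ∀ τ ∈ T, Tendsto (fun l => W.ePar τ l + W.ePar τ (-l)) atTop (𝓝 0)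
  Theta_limits : ∀ τ ∈ T, ∀ i j,
    Tendsto (fun l => W.Theta τ l i j + W.Theta τ (-l) i j) atTop (𝓝 0)

end

/-! Two properties of D⁻¹ carry the analysis. It is skew: for rapidly decreasing a, b the product
D⁻¹a · D⁻¹b has the same limit (∫a)(∫b)/4 at both ends, so integration by parts leaves no boundary
term (`Rapid.integral_mul_Dinv`). And it is the only antiderivative whose limits cancel (`eq_Dinv`),
so a rapidly decreasing antiderivative is automatically D⁻¹; nonlocal identities are proved by
exhibiting one and differentiating it. Moreover J, H, R and their forms are polynomial in t along a
line v + th, so directional derivatives are coefficients of t and no limit has to be exchanged with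
an integral.

Symplectic operator: the v-dependent part of ω_v(f, g) is the skew pairing of v·f with v·g. Its
derivative consists of two such pairings, and in the cyclic sum the six terms cancel in pairs.

Hamiltonian operator: put X = D⁻¹(v∧ξ), Y = D⁻¹(v∧η), Z = D⁻¹(v∧ζ). The cyclic sum in the Jacobi
identity is the integral of the derivative of ζ·Yξ + ξ·Zη + η·Xζ + tr(XYZ) (`jacobi_density`).
Exactness makes X, Y, Z rapidly decreasing, so this integral vanishes.

Recursion operator: the Nijenhuis torsion is computed directly. Put B_f = D⁻¹(v∧Jf) and K = R'[f]g -
R'[g]f. First, K has a closed form without second derivatives (`opR_commutator`). Then J'[Rf]g -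
J'[Rg]f equals JK + Jg⌋B_f - Jf⌋B_g, by `deriv_opRComm` and `Dinv_inner_opR_sub`. Finally D⁻¹(Rf∧g')
- D⁻¹(Rg∧f') - D⁻¹(v∧JK) = Jf∧Jg - [B_f, B_g] (`wedgePrim_identity`), the only place where exactness
enters. With these, all terms of the torsion cancel.

Flows: metric compatibility, vanishing torsion and constant curvature, written in the adapted
orthonormal frame, are Cartan's structure equations (`IsFlowVars.structureEqs`). The equations for
the tangential component and for Θ are integrated by D⁻¹, with constants fixed by the normalization;
substitution into the other two gives the operators J and H. -/

/-! ## Rapidly decreasing functions -/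

section Rapid

variable {E F G : Type*} [NormedAddCommGroup E] [NormedSpace ℝ E] [NormedAddCommGroup F]
  [NormedSpace ℝ F] [NormedAddCommGroup G] [NormedSpace ℝ G]

/-- `f` is a rapidly decreasing function. -/
def Rapid (f : ℝ → E) : Prop := ∃ g : 𝓢(ℝ, E), ⇑g = f

theorem SchwartzMap.rapid (f : 𝓢(ℝ, E)) : Rapid ⇑f := ⟨f, rfl⟩

namespace Rapid

variable {f g : ℝ → E}

theorem add (hf : Rapid f) (hg : Rapid g) : Rapid (fun x => f x + g x) := by
  obtain ⟨f, rfl⟩ := hf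
  obtain ⟨g, rfl⟩ := hg
  exact ⟨f + g, rfl⟩

theorem sub (hf : Rapid f) (hg : Rapid g) : Rapid (fun x => f x - g x) := by
  obtain ⟨f, rfl⟩ := hf
  obtain ⟨g, rfl⟩ := hg
  exact ⟨f - g, rfl⟩

theorem const_smul (c : ℝ) (hf : Rapid f) : Rapid (fun x => c • f x) := by
  obtain ⟨f, rfl⟩ := hf
  exact ⟨c • f, rfl⟩

theorem sum {ι : Type*} {s : Finset ι} {f : ι → ℝ → E} (hf : ∀ i, Rapid (f i)) :
    Rapid (fun x => ∑ i ∈ s, f i x) := by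
  choose g hg using hf
  refine ⟨∑ i ∈ s, g i, ?_⟩
  ext x
  simp [← hg]

protected theorem deriv (hf : Rapid f) : Rapid (deriv f) := by
  obtain ⟨f, rfl⟩ := hf
  exact ⟨SchwartzMap.derivCLM ℝ E f, by ext x; simp⟩

theorem clm (L : E →L[ℝ] F) (hf : Rapid f) : Rapid (fun x => L (f x)) := by
  obtain ⟨f, rfl⟩ := hf
  exact ⟨f.postcompCLM L, by ext x; simp⟩

theorem hasTemperateGrowth (hf : Rapid f) : f.HasTemperateGrowth := by
  obtain ⟨f, rfl⟩ := hf
  exact f.hasTemperateGrowth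

/-- Only one factor has to decay. This is what allows products with D⁻¹ of something, which is
bounded but in general has nonzero limits. -/
theorem bilin (B : E →L[ℝ] F →L[ℝ] G) {a : ℝ → F} (hf : Rapid f) (ha : a.HasTemperateGrowth) :
    Rapid (fun x => B (f x) (a x)) := by
  obtain ⟨f, rfl⟩ := hf
  exact ⟨SchwartzMap.bilinLeftCLM B ha f, by ext x; simp⟩

theorem smul {a : ℝ → ℝ} (ha : a.HasTemperateGrowth) (hf : Rapid f) :
    Rapid (fun x => a x • f x) := by
  simpa using hf.bilin (ContinuousLinearMap.lsmul ℝ ℝ).flip ha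

theorem mul_left {a b : ℝ → ℝ} (ha : a.HasTemperateGrowth) (hb : Rapid b) :
    Rapid (fun x => a x * b x) :=
  hb.smul ha

theorem mul_right {a b : ℝ → ℝ} (ha : Rapid a) (hb : b.HasTemperateGrowth) :
    Rapid (fun x => a x * b x) := by
  simpa only [mul_comm] using ha.mul_left hb

theorem mul {a b : ℝ → ℝ} (ha : Rapid a) (hb : Rapid b) : Rapid (fun x => a x * b x) :=
  hb.mul_left ha.hasTemperateGrowth

theorem integrable (hf : Rapid f) : Integrable f := by
  obtain ⟨f, rfl⟩ := hf
  exact f.integrable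

theorem differentiable (hf : Rapid f) : Differentiable ℝ f := by
  obtain ⟨f, rfl⟩ := hf
  exact f.differentiable

theorem continuous (hf : Rapid f) : Continuous f := hf.differentiable.continuous

theorem hasDerivAt (hf : Rapid f) (x : ℝ) : HasDerivAt f (deriv f x) x :=
  (hf.differentiable x).hasDerivAt

theorem tendsto_atTop (hf : Rapid f) : Tendsto f atTop (𝓝 0) := by
  obtain ⟨f, rfl⟩ := hf
  exact (f.tendsto_cocompact).mono_left atTop_le_cocompact

theorem tendsto_atBot (hf : Rapid f) : Tendsto f atBot (𝓝 0) := by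
  obtain ⟨f, rfl⟩ := hf
  exact (f.tendsto_cocompact).mono_left atBot_le_cocompact

theorem integral_deriv_eq_zero [CompleteSpace E] {f' : ℝ → E} (hf : Rapid f)
    (h : ∀ x, HasDerivAt f (f' x) x) : ∫ x, f' x = 0 := by
  have e : f' = deriv f := funext fun x => (h x).deriv.symm
  have := integral_of_hasDerivAt_of_tendsto h (e ▸ hf.deriv.integrable) hf.tendsto_atBot
    hf.tendsto_atTop
  simpa using this

variable {k : ℕ} {u v : ℝ → EV k}

protected theorem inner (hu : Rapid u) (hv : Rapid v) : Rapid (fun x => inner ℝ (u x) (v x)) :=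
  hu.bilin (innerSL ℝ) hv.hasTemperateGrowth

theorem coord (hu : Rapid u) (i : Fin k) : Rapid (fun x => u x i) :=
  hu.clm (EuclideanSpace.proj i : EV k →L[ℝ] ℝ)

theorem hasDerivAt_coord (hu : Rapid u) (x : ℝ) (i : Fin k) :
    HasDerivAt (fun x => u x i) (deriv u x i) x :=
  (EuclideanSpace.proj i : EV k →L[ℝ] ℝ).hasFDerivAt.comp_hasDerivAt x (hu.hasDerivAt x)

theorem toLp {a : Fin k → ℝ → ℝ} (ha : ∀ j, Rapid (a j)) :
    Rapid (fun x => (WithLp.toLp 2 (fun j => a j x) : EV k)) := by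
  have h : Rapid (fun x => ∑ j, (ContinuousLinearMap.toSpanSingleton ℝ
      (EuclideanSpace.single j 1 : EV k)) (a j x)) := Rapid.sum fun j => (ha j).clm _
  convert h using 2 with x
  ext i
  simp [Finset.sum_apply, Pi.single_apply]

theorem wedge (hu : Rapid u) (hv : Rapid v) (i j : Fin k) : Rapid (wedge u v i j) :=
  ((hu.coord i).mul (hv.coord j)).sub ((hv.coord i).mul (hu.coord j))

end Rapid

end Rapid

/-! ## The operator `D⁻¹` -/

section Dinv

theorem Dinv_eq {g : ℝ → ℝ} (hg : Integrable g) (x : ℝ) :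
    Dinv g x = (∫ y in Iic x, g y) - (1 / 2) * ∫ y, g y := by
  have h := intervalIntegral.integral_Iic_add_Ioi (b := x) (f := g) (μ := volume)
    hg.integrableOn hg.integrableOn
  rw [Dinv, ← h]
  ring

theorem hasDerivAt_Dinv {g : ℝ → ℝ} (hg : Integrable g) (hc : Continuous g) (x : ℝ) :
    HasDerivAt (Dinv g) (g x) x := by
  have e : Dinv g = fun x => (∫ y in (0 : ℝ)..x, g y)
      + ((∫ y in Iic 0, g y) - (1 / 2) * ∫ y, g y) := by
    ext x
    rw [Dinv_eq hg, ← intervalIntegral.integral_Iic_sub_Iic hg.integrableOn hg.integrableOn]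
    ring
  rw [e]
  exact (intervalIntegral.integral_hasDerivAt_right hg.intervalIntegrable
    (hc.stronglyMeasurableAtFilter _ _) hc.continuousAt).add_const _

theorem Dinv_add {f g : ℝ → ℝ} (hf : Integrable f) (hg : Integrable g) (x : ℝ) :
    Dinv (fun y => f y + g y) x = Dinv f x + Dinv g x := by
  simp only [Dinv, integral_add hf.integrableOn hg.integrableOn]
  ring

theorem Dinv_const_mul (c : ℝ) (g : ℝ → ℝ) (x : ℝ) : Dinv (fun y => c * g y) x = c * Dinv g x := by
  simp only [Dinv, integral_const_mul]
  ring

theorem Dinv_neg (g : ℝ → ℝ) (x : ℝ) : Dinv (fun y => -g y) x = -Dinv g x := by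
  simp only [Dinv, integral_neg]
  ring

theorem Dinv_sub {f g : ℝ → ℝ} (hf : Integrable f) (hg : Integrable g) (x : ℝ) :
    Dinv (fun y => f y - g y) x = Dinv f x - Dinv g x := by
  simp only [Dinv, integral_sub hf.integrableOn hg.integrableOn]
  ring

theorem Dinv_sum {ι : Type*} (s : Finset ι) {f : ι → ℝ → ℝ} (hf : ∀ i, Integrable (f i)) (x : ℝ) :
    Dinv (fun y => ∑ i ∈ s, f i y) x = ∑ i ∈ s, Dinv (f i) x := by
  simp only [Dinv]
  rw [integral_finsetSum _ fun i _ => (hf i).integrableOn,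
    integral_finsetSum _ fun i _ => (hf i).integrableOn, ← Finset.sum_sub_distrib, Finset.mul_sum]

theorem abs_Dinv_le {g : ℝ → ℝ} (hg : Integrable g) (x : ℝ) : |Dinv g x| ≤ (∫ y, |g y|) := by
  have h1 : |∫ y in Iic x, g y| ≤ ∫ y, |g y| := (abs_integral_le_integral_abs).trans
    (setIntegral_le_integral hg.abs (Eventually.of_forall fun _ => abs_nonneg _))
  have h2 : |∫ y in Ioi x, g y| ≤ ∫ y, |g y| := (abs_integral_le_integral_abs).trans
    (setIntegral_le_integral hg.abs (Eventually.of_forall fun _ => abs_nonneg _))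
  rw [Dinv, abs_le]
  rw [abs_le] at h1 h2
  constructor <;> linarith

theorem tendsto_Dinv_atTop {g : ℝ → ℝ} (hg : Integrable g) :
    Tendsto (Dinv g) atTop (𝓝 ((1 / 2) * ∫ y, g y)) := by
  have h := (tendsto_setIntegral_of_monotone (μ := volume) (f := g) (s := fun x : ℝ => Iic x)
    (fun _ => measurableSet_Iic) (fun a b h => Iic_subset_Iic.2 h) hg.integrableOn)
  rw [iUnion_Iic, setIntegral_univ] at h
  have h2 := h.sub_const ((1 / 2) * ∫ y, g y)
  rw [funext (Dinv_eq hg)]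
  convert h2 using 2
  ring

theorem tendsto_Dinv_atBot {g : ℝ → ℝ} (hg : Integrable g) :
    Tendsto (Dinv g) atBot (𝓝 (-((1 / 2) * ∫ y, g y))) := by
  -- The half-lines are parametrized by -x, so that they shrink to the empty set as x → +∞.
  have h := (tendsto_setIntegral_of_antitone (μ := volume) (f := g)
    (s := fun x : ℝ => Iic (-x)) (fun _ => measurableSet_Iic)
    (fun a b h => Iic_subset_Iic.2 (neg_le_neg h)) ⟨0, hg.integrableOn⟩)
  have e : (⋂ x : ℝ, Iic (-x)) = ∅ := by
    ext y
    simp only [mem_iInter, mem_Iic, mem_empty_iff_false, iff_false, not_forall, not_le]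
    exact ⟨-y + 1, by linarith⟩
  rw [e, setIntegral_empty] at h
  have h2 := (h.comp tendsto_neg_atBot_atTop).sub_const ((1 / 2) * ∫ y, g y)
  rw [funext (Dinv_eq hg)]
  simpa [Function.comp_def] using h2

/-- `D⁻¹ g` is the antiderivative of `g` whose limits at `±∞` add up to zero. -/
theorem eq_Dinv {F g : ℝ → ℝ} (hg : Integrable g) (hc : Continuous g)
    (hF : ∀ x, HasDerivAt F (g x) x)
    (hl : Tendsto (fun x => F x + F (-x)) atTop (𝓝 0)) : F = Dinv g := by
  have hd : ∀ x, HasDerivAt (fun x => F x - Dinv g x) 0 x := fun x => by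
    simpa using (hF x).fun_sub (hasDerivAt_Dinv hg hc x)
  have hconst : ∀ x y, F x - Dinv g x = F y - Dinv g y :=
    is_const_of_deriv_eq_zero (fun x => (hd x).differentiableAt) (fun x => (hd x).deriv)
  have hl2 : Tendsto (fun x => Dinv g x + Dinv g (-x)) atTop (𝓝 0) := by
    simpa using (tendsto_Dinv_atTop hg).add ((tendsto_Dinv_atBot hg).comp tendsto_neg_atTop_atBot)
  have hl3 := hl.sub hl2
  -- The difference F - D⁻¹g is constant, and the sum of its values at x and -x tends to zero; hence
  -- the constant is zero.
  have e : (fun x => F x + F (-x) - (Dinv g x + Dinv g (-x))) = fun _ => 2 * (F 0 - Dinv g 0) := by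
    ext x
    have h1 := hconst x 0
    have h2 := hconst (-x) 0
    linarith
  rw [e] at hl3
  have h0 := tendsto_nhds_unique tendsto_const_nhds hl3
  ext x
  have h1 := hconst x 0
  linarith

namespace Rapid

variable {a b : ℝ → ℝ}

theorem hasDerivAt_Dinv (ha : Rapid a) (x : ℝ) : HasDerivAt (Dinv a) (a x) x :=
  _root_.hasDerivAt_Dinv ha.integrable ha.continuous x

/-- D⁻¹a is bounded by ∫|a|, and its derivative is rapidly decreasing. -/
theorem hasTemperateGrowth_Dinv (ha : Rapid a) : (Dinv a).HasTemperateGrowth := by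
  refine Function.HasTemperateGrowth.of_fderiv (k := 0) (C := ∫ y, |a y|) ?_
    (fun x => (ha.hasDerivAt_Dinv x).differentiableAt)
    (fun x => by simpa using abs_Dinv_le ha.integrable x)
  have e : fderiv ℝ (Dinv a) = fun x => ContinuousLinearMap.toSpanSingleton ℝ (a x) := by
    ext x
    simp [(ha.hasDerivAt_Dinv x).hasFDerivAt.fderiv]
  rw [e]
  exact (ha.clm (ContinuousLinearMap.toSpanSingletonCLE (𝕜 := ℝ) (E := ℝ)).toContinuousLinearMap).hasTemperateGrowth

/-- A rapidly decreasing antiderivative vanishes at both ends, so it meets the normalization of D⁻¹.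
The nonlocal identities below are obtained in this way. -/
theorem Dinv_eq_of_hasDerivAt (ha : Rapid a) (h : ∀ x, HasDerivAt a (b x) x) : Dinv b = a := by
  have e : b = deriv a := funext fun x => (h x).deriv.symm
  subst e
  refine (eq_Dinv ha.deriv.integrable ha.deriv.continuous h ?_).symm
  simpa using ha.tendsto_atTop.add (ha.tendsto_atBot.comp tendsto_neg_atTop_atBot)

/-- The limits of D⁻¹a and D⁻¹b at -∞ are minus those at +∞, so their product takes equal values at
the two ends and the boundary terms cancel. -/
theorem integral_mul_Dinv (ha : Rapid a) (hb : Rapid b) :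
    ∫ x, a x * Dinv b x = -∫ x, b x * Dinv a x := by
  have h1 := (ha.mul_right hb.hasTemperateGrowth_Dinv).integrable
  have h2 := (hb.mul_right ha.hasTemperateGrowth_Dinv).integrable
  have hd : ∀ x, HasDerivAt (fun x => Dinv a x * Dinv b x) (a x * Dinv b x + b x * Dinv a x) x :=
    fun x => ((ha.hasDerivAt_Dinv x).fun_mul (hb.hasDerivAt_Dinv x)).congr_deriv (by ring)
  have h := integral_of_hasDerivAt_of_tendsto hd (h1.add h2)
    ((tendsto_Dinv_atBot ha.integrable).mul (tendsto_Dinv_atBot hb.integrable))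
    ((tendsto_Dinv_atTop ha.integrable).mul (tendsto_Dinv_atTop hb.integrable))
  rw [integral_add h1 h2] at h
  linarith

end Rapid

end Dinv

/-! ## Contraction of vectors with matrices -/

section Contraction

variable {k : ℕ}

/-- `v ⌋ B`, with the entries `∑ᵢ vᵢ Bᵢⱼ`. -/
def contr (v : EV k) (B : Fin k → Fin k → ℝ) : EV k :=
  WithLp.toLp 2 (fun j => ∑ i, v i * B i j)

@[simp] theorem contr_apply (v : EV k) (B : Fin k → Fin k → ℝ) (j : Fin k) :
    contr v B j = ∑ i, v i * B i j := rfl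

theorem contr_add_left (u v : EV k) (B : Fin k → Fin k → ℝ) :
    contr (u + v) B = contr u B + contr v B := by
  ext j
  simp [add_mul, Finset.sum_add_distrib]

theorem contr_smul_left (c : ℝ) (v : EV k) (B : Fin k → Fin k → ℝ) :
    contr (c • v) B = c • contr v B := by
  ext j
  simp [Finset.mul_sum, mul_assoc]

theorem contr_add_right (v : EV k) (A B : Fin k → Fin k → ℝ) :
    contr v (A + B) = contr v A + contr v B := by
  ext j
  simp [mul_add, Finset.sum_add_distrib]

theorem contr_smul_right (c : ℝ) (v : EV k) (B : Fin k → Fin k → ℝ) :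
    contr v (c • B) = c • contr v B := by
  ext j
  simp [Finset.mul_sum, mul_left_comm]

theorem contr_neg_right (v : EV k) (B : Fin k → Fin k → ℝ) : contr v (-B) = -contr v B := by
  ext j
  simp

theorem contr_sub_right (v : EV k) (A B : Fin k → Fin k → ℝ) :
    contr v (A - B) = contr v A - contr v B := by
  simp [sub_eq_add_neg, contr_add_right, contr_neg_right]

theorem contr_wedge (u v w : ℝ → EV k) (x : ℝ) :
    contr (u x) (fun i j => wedge v w i j x)
      = inner ℝ (u x) (v x) • w x - inner ℝ (u x) (w x) • v x := by
  ext j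
  simp only [contr_apply, wedge, PiLp.sub_apply, PiLp.smul_apply, smul_eq_mul, PiLp.inner_apply,
    RCLike.inner_apply, conj_trivial, Finset.sum_mul, mul_sub, Finset.sum_sub_distrib]
  congr 1 <;> exact Finset.sum_congr rfl fun i _ => by ring

end Contraction

/-! ## The operators on rapidly decreasing functions -/

section Operators

variable {k : ℕ} {u v w f g h : ℝ → EV k}

theorem wedge_swap (f g : ℝ → EV k) (i j : Fin k) : wedge f g j i = fun x => -wedge f g i j x := by
  ext x
  simp only [wedge]
  ring

theorem wedge_add_right (v f g : ℝ → EV k) (i j : Fin k) :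
    wedge v (fun x => f x + g x) i j = fun x => wedge v f i j x + wedge v g i j x := by
  ext x
  simp only [wedge, PiLp.add_apply]
  ring

theorem wedge_smul_right (c : ℝ) (v f : ℝ → EV k) (i j : Fin k) :
    wedge v (fun x => c • f x) i j = fun x => c * wedge v f i j x := by
  ext x
  simp only [wedge, PiLp.smul_apply, smul_eq_mul]
  ring

theorem opH_eq (v f : ℝ → EV k) (x : ℝ) :
    opH v f x = deriv f x + contr (v x) (fun i j => Dinv (wedge v f i j) x) := rfl

theorem Rapid.contr {B : Fin k → Fin k → ℝ → ℝ} (hu : Rapid u)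
    (hB : ∀ i j, (B i j).HasTemperateGrowth) : Rapid (fun x => contr (u x) (fun i j => B i j x)) :=
  Rapid.toLp fun j => Rapid.sum fun i => (hu.coord i).mul_right (hB i j)

theorem Rapid.hasTemperateGrowth_inner_Dinv (hv : Rapid v) (hf : Rapid f) :
    (Dinv fun y => inner ℝ (v y) (f y)).HasTemperateGrowth :=
  (hv.inner hf).hasTemperateGrowth_Dinv

theorem Rapid.opJ (hv : Rapid v) (hf : Rapid f) : Rapid (opJ v f) :=
  hf.deriv.add (hv.smul (hv.hasTemperateGrowth_inner_Dinv hf))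

theorem Rapid.opH (hv : Rapid v) (hf : Rapid f) : Rapid (opH v f) :=
  hf.deriv.add (hv.contr fun i j => (hv.wedge hf i j).hasTemperateGrowth_Dinv)

theorem Rapid.opR (hv : Rapid v) (hf : Rapid f) : Rapid (opR v f) := hv.opH (hv.opJ hf)

theorem Rapid.deriv_add (hf : Rapid f) (hg : Rapid g) (x : ℝ) :
    deriv (fun y => f y + g y) x = deriv f x + deriv g x :=
  ((hf.hasDerivAt x).fun_add (hg.hasDerivAt x)).deriv

theorem Rapid.deriv_smul (hf : Rapid f) (c : ℝ) (x : ℝ) :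
    deriv (fun y => c • f y) x = c • deriv f x :=
  ((hf.hasDerivAt x).fun_const_smul c).deriv

theorem opJ_add (hv : Rapid v) (hf : Rapid f) (hg : Rapid g) :
    opJ v (fun x => f x + g x) = fun x => opJ v f x + opJ v g x := by
  ext1 x
  simp only [opJ, hf.deriv_add hg, inner_add_right,
    Dinv_add (hv.inner hf).integrable (hv.inner hg).integrable]
  module

theorem opJ_smul (c : ℝ) (v : ℝ → EV k) (hf : Rapid f) :
    opJ v (fun x => c • f x) = fun x => c • opJ v f x := by
  ext1 x
  simp only [opJ, hf.deriv_smul, inner_smul_right, Dinv_const_mul]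
  module

theorem opH_add (hv : Rapid v) (hf : Rapid f) (hg : Rapid g) :
    opH v (fun x => f x + g x) = fun x => opH v f x + opH v g x := by
  ext1 x
  simp only [opH_eq, hf.deriv_add hg, wedge_add_right,
    Dinv_add (hv.wedge hf _ _).integrable (hv.wedge hg _ _).integrable]
  have := contr_add_right (v x) (fun i j => Dinv (wedge v f i j) x)
    (fun i j => Dinv (wedge v g i j) x)
  simp only [Pi.add_def] at this
  rw [this]
  module

theorem opH_smul (c : ℝ) (v : ℝ → EV k) (hf : Differentiable ℝ f) :
    opH v (fun x => c • f x) = fun x => c • opH v f x := by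
  ext1 x
  simp only [opH_eq, ((hf x).hasDerivAt.fun_const_smul c).deriv, wedge_smul_right, Dinv_const_mul]
  have := contr_smul_right c (v x) (fun i j => Dinv (wedge v f i j) x)
  simp only [Pi.smul_def, smul_eq_mul] at this
  rw [this]
  module

theorem isLinearFamily_opJ : IsLinearFamily (opJ (k := k)) where
  maps v f := v.rapid.opJ f.rapid
  add v f g := opJ_add v.rapid f.rapid g.rapid
  smul c v f := opJ_smul c v f.rapid

theorem isLinearFamily_opH : IsLinearFamily (opH (k := k)) where
  maps v f := v.rapid.opH f.rapid
  add v f g := opH_add v.rapid f.rapid g.rapid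
  smul c v f := opH_smul c v f.rapid.differentiable

theorem isLinearFamily_opR : IsLinearFamily (opR (k := k)) where
  maps v f := v.rapid.opR f.rapid
  add v f g := (congrArg (opH v) (opJ_add v.rapid f.rapid g.rapid)).trans
    (opH_add v.rapid (v.rapid.opJ f.rapid) (v.rapid.opJ g.rapid))
  smul c v f := (congrArg (opH v) (opJ_smul c v f.rapid)).trans
    (opH_smul c v (v.rapid.opJ f.rapid).differentiable)

/-! ### Orthogonal invariance -/

theorem deriv_linearIsometryEquiv_comp (Q : EV k ≃ₗᵢ[ℝ] EV k) (hf : Rapid f) (x : ℝ) :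
    deriv (fun y => Q (f y)) x = Q (deriv f x) :=
  ((Q.toContinuousLinearEquiv.toContinuousLinearMap).hasFDerivAt.comp_hasDerivAt x
    (hf.hasDerivAt x)).deriv

theorem isOrthInvariant_opJ : IsOrthInvariant (opJ (k := k)) := by
  intro Q v f x
  simp [opJ, deriv_linearIsometryEquiv_comp Q f.rapid]

/-- For vectors a, b independent of the integration variable, their coordinates pass through D⁻¹.
What remains involves inner products only, which makes the orthogonal invariance of H evident. -/
theorem inner_contr_Dinv_wedge (hv : Rapid v) (hf : Rapid f) (a b : EV k) (x : ℝ) :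
    inner ℝ a (contr b (fun i j => Dinv (wedge v f i j) x))
      = Dinv (fun y => inner ℝ b (v y) * inner ℝ a (f y) - inner ℝ b (f y) * inner ℝ a (v y)) x := by
  have e : (fun y => inner ℝ b (v y) * inner ℝ a (f y) - inner ℝ b (f y) * inner ℝ a (v y))
      = fun y => ∑ j, ∑ i, (a j * b i) * wedge v f i j y := by
    ext y
    simp only [PiLp.inner_apply, RCLike.inner_apply, conj_trivial, Finset.sum_mul_sum, wedge,
      ← Finset.sum_sub_distrib]
    rw [Finset.sum_comm]
    exact Finset.sum_congr rfl fun j _ => Finset.sum_congr rfl fun i _ => by ring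
  have hi : ∀ i j, Integrable fun y => (a j * b i) * wedge v f i j y := fun i j =>
    (hv.wedge hf i j).integrable.const_mul _
  rw [e, Dinv_sum _ fun j => integrable_finsetSum _ fun i _ => hi i j]
  simp only [PiLp.inner_apply, RCLike.inner_apply, conj_trivial, contr_apply, Finset.sum_mul]
  refine Finset.sum_congr rfl fun j _ => ?_
  rw [Dinv_sum _ fun i => hi i j]
  refine Finset.sum_congr rfl fun i _ => ?_
  rw [Dinv_const_mul]
  ring

theorem isOrthInvariant_opH : IsOrthInvariant (opH (k := k)) := by
  intro Q v f x
  have hv := v.rapid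
  have hf := f.rapid
  have hQ : ∀ {w : ℝ → EV k}, Rapid w → Rapid (fun y => Q (w y)) := fun hw =>
    hw.clm Q.toContinuousLinearEquiv.toContinuousLinearMap
  rw [opH_eq, opH_eq, deriv_linearIsometryEquiv_comp Q hf, map_add]
  congr 1
  refine ext_inner_left ℝ fun a => ?_
  obtain ⟨a, rfl⟩ := Q.surjective a
  rw [inner_contr_Dinv_wedge (hQ hv) (hQ hf), Q.inner_map_map, inner_contr_Dinv_wedge hv hf]
  simp only [Q.inner_map_map]

end Operators

/-! ## The pairing `∫ a D⁻¹ b` -/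

section Pairing

/-- `∫ a D⁻¹ b dl`. -/
noncomputable def dinvPairing (a b : ℝ → ℝ) : ℝ := ∫ x, a x * Dinv b x

variable {a b c d : ℝ → ℝ}

theorem Rapid.integrable_mul_Dinv (ha : Rapid a) (hb : Rapid b) :
    Integrable fun x => a x * Dinv b x :=
  (ha.mul_right hb.hasTemperateGrowth_Dinv).integrable

theorem dinvPairing_swap (ha : Rapid a) (hb : Rapid b) : dinvPairing a b = -dinvPairing b a :=
  ha.integral_mul_Dinv hb

theorem dinvPairing_neg_right (a b : ℝ → ℝ) :
    dinvPairing a (fun x => -b x) = -dinvPairing a b := by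
  simp [dinvPairing, Dinv_neg, integral_neg]

theorem dinvPairing_sub_left (ha : Rapid a) (hb : Rapid b) (hc : Rapid c) :
    dinvPairing (fun x => a x - b x) c = dinvPairing a c - dinvPairing b c := by
  simp only [dinvPairing, sub_mul]
  exact integral_sub (ha.integrable_mul_Dinv hc) (hb.integrable_mul_Dinv hc)

/-- Bilinearity gives an exact quadratic polynomial in t, so the derivative at 0 needs no
differentiation under the integral. -/
theorem dinvPairing_line (ha : Rapid a) (hb : Rapid b) (hc : Rapid c) (hd : Rapid d) (t : ℝ) :
    dinvPairing (fun x => a x + t * b x) (fun x => c x + t * d x)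
      = dinvPairing a c + t * (dinvPairing b c + dinvPairing a d) + t ^ 2 * dinvPairing b d := by
  have hd' : ∀ x, Dinv (fun y => c y + t * d y) x = Dinv c x + t * Dinv d x := fun x => by
    rw [Dinv_add hc.integrable (hd.integrable.const_mul t), Dinv_const_mul]
  have h1 := ha.integrable_mul_Dinv hc
  have h2 := hb.integrable_mul_Dinv hc
  have h3 := ha.integrable_mul_Dinv hd
  have h4 := hb.integrable_mul_Dinv hd
  have h23 := (h2.fun_add h3).const_mul t
  simp only [dinvPairing, hd']
  rw [← integral_add h2 h3, ← integral_const_mul, ← integral_const_mul,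
    ← integral_add h1 h23, ← integral_add (h1.fun_add h23) (h4.const_mul _)]
  exact integral_congr_ae (Eventually.of_forall fun x => by ring)

theorem hasDerivAt_dinvPairing_line (ha : Rapid a) (hb : Rapid b) (hc : Rapid c) (hd : Rapid d) :
    HasDerivAt (fun t : ℝ => dinvPairing (fun x => a x + t * b x) (fun x => c x + t * d x))
      (dinvPairing b c + dinvPairing a d) 0 := by
  simp only [dinvPairing_line ha hb hc hd]
  have h := (((hasDerivAt_id (0 : ℝ)).mul_const (dinvPairing b c + dinvPairing a d)).const_add
    (dinvPairing a c)).fun_add (((hasDerivAt_id (0 : ℝ)).fun_pow 2).mul_const (dinvPairing b d))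
  simpa using h

end Pairing

/-! ### Skewness, closedness and first variations of the bilinear forms of J and H -/

section Forms

variable {k : ℕ} {u v w f g h : ℝ → EV k}

theorem integral_inner_deriv (hf : Rapid f) (hg : Rapid g) :
    ∫ x, (inner ℝ (f x) (deriv g x) : ℝ) = -∫ x, (inner ℝ (g x) (deriv f x) : ℝ) := by
  have h := (hf.inner hg).integral_deriv_eq_zero
    (fun x => (hf.hasDerivAt x).inner ℝ (hg.hasDerivAt x))
  rw [integral_add (hf.inner hg.deriv).integrable (hf.deriv.inner hg).integrable] at h
  simp only [real_inner_comm (g _)] at h ⊢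
  linarith

/-! ### The symplectic operator -/

theorem opForm_opJ (hv : Rapid v) (hf : Rapid f) (hg : Rapid g) :
    opForm opJ v f g = (∫ x, (inner ℝ (f x) (deriv g x) : ℝ))
      + dinvPairing (fun x => inner ℝ (v x) (f x)) (fun x => inner ℝ (v x) (g x)) := by
  rw [dinvPairing, ← integral_add (hf.inner hg.deriv).integrable
    ((hv.inner hf).integrable_mul_Dinv (hv.inner hg))]
  refine integral_congr_ae (Eventually.of_forall fun x => ?_)
  simp only [opJ, inner_add_right, inner_smul_right, real_inner_comm (v x)]
  ring

theorem hasDerivAt_opForm_opJ (v h f g : 𝓢(ℝ, EV k)) :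
    HasDerivAt (fun t : ℝ => opForm opJ (⇑v + t • ⇑h) f g)
      (dinvPairing (fun x => inner ℝ (h x) (f x)) (fun x => inner ℝ (v x) (g x))
        + dinvPairing (fun x => inner ℝ (v x) (f x)) (fun x => inner ℝ (h x) (g x))) 0 := by
  have e : ∀ t : ℝ, opForm opJ (⇑v + t • ⇑h) f g = (∫ x, (inner ℝ (f x) (deriv g x) : ℝ))
      + dinvPairing (fun x => inner ℝ (v x) (f x) + t * inner ℝ (h x) (f x))
        (fun x => inner ℝ (v x) (g x) + t * inner ℝ (h x) (g x)) := fun t => by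
    refine (opForm_opJ (v + t • h).rapid f.rapid g.rapid).trans ?_
    simp [inner_add_left, inner_smul_left]
  rw [funext e]
  exact (hasDerivAt_dinvPairing_line (v.rapid.inner f.rapid) (h.rapid.inner f.rapid)
    (v.rapid.inner g.rapid) (h.rapid.inner g.rapid)).const_add _

theorem isSymplecticOperator_opJ : IsSymplecticOperator (opJ (k := k)) where
  linear := isLinearFamily_opJ
  skew v f g := by
    rw [opForm_opJ v.rapid f.rapid g.rapid, opForm_opJ v.rapid g.rapid f.rapid,
      integral_inner_deriv f.rapid g.rapid,
      dinvPairing_swap (v.rapid.inner f.rapid) (v.rapid.inner g.rapid)]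
    ring
  differentiable v h f g := (hasDerivAt_opForm_opJ v h f g).differentiableAt
  closed v f g h := by
    simp only [opFormDeriv, (hasDerivAt_opForm_opJ _ _ _ _).deriv]
    -- Each of the six pairings in the cyclic sum has a partner with its arguments exchanged.
    have h1 := dinvPairing_swap (v.rapid.inner f.rapid) (g.rapid.inner h.rapid)
    have h2 := dinvPairing_swap (v.rapid.inner g.rapid) (h.rapid.inner f.rapid)
    have h3 := dinvPairing_swap (v.rapid.inner h.rapid) (f.rapid.inner g.rapid)
    simp only [real_inner_comm (f _) (h _), real_inner_comm (g _) (h _),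
      real_inner_comm (f _) (g _)] at h1 h2 h3 ⊢
    linarith

/-! ### The Hamiltonian operator -/

/-- `∑ᵢⱼ ∫ uᵢ fⱼ D⁻¹(w ∧ g)ᵢⱼ dl`. -/
noncomputable def wedgePairing (u f w g : ℝ → EV k) : ℝ :=
  ∑ i, ∑ j, dinvPairing (fun x => u x i * f x j) (wedge w g i j)

/-- Since D⁻¹(w∧g) is a skew matrix, u⊗f may be replaced by its skew part. In this form the two
arguments play the same role, and skewness follows from that of the scalar pairing. -/
theorem wedgePairing_eq_half (hu : Rapid u) (hf : Rapid f) (hw : Rapid w) (hg : Rapid g) :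
    wedgePairing u f w g = (1 / 2) * ∑ i, ∑ j, dinvPairing (wedge u f i j) (wedge w g i j) := by
  have h1 : wedgePairing u f w g
      = -∑ i, ∑ j, dinvPairing (fun x => f x i * u x j) (wedge w g i j) := by
    rw [wedgePairing, Finset.sum_comm, ← Finset.sum_neg_distrib]
    refine Finset.sum_congr rfl fun i _ => ?_
    rw [← Finset.sum_neg_distrib]
    refine Finset.sum_congr rfl fun j _ => ?_
    rw [wedge_swap, dinvPairing_neg_right]
    simp only [mul_comm (f _ _)]
  have h2 : ∑ i, ∑ j, dinvPairing (wedge u f i j) (wedge w g i j) = wedgePairing u f w g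
      - ∑ i, ∑ j, dinvPairing (fun x => f x i * u x j) (wedge w g i j) := by
    simp only [wedgePairing, ← Finset.sum_sub_distrib]
    refine Finset.sum_congr rfl fun i _ => Finset.sum_congr rfl fun j _ => ?_
    exact dinvPairing_sub_left ((hu.coord i).mul (hf.coord j)) ((hf.coord i).mul (hu.coord j))
      (hw.wedge hg i j)
  linarith

theorem wedgePairing_swap (hu : Rapid u) (hf : Rapid f) (hw : Rapid w) (hg : Rapid g) :
    wedgePairing u f w g = -wedgePairing w g u f := by
  rw [wedgePairing_eq_half hu hf hw hg, wedgePairing_eq_half hw hg hu hf, ← mul_neg]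
  simp only [← Finset.sum_neg_distrib]
  congr 1
  exact Finset.sum_congr rfl fun i _ => Finset.sum_congr rfl fun j _ =>
    dinvPairing_swap (hu.wedge hf i j) (hw.wedge hg i j)

theorem opForm_opH (hv : Rapid v) (hf : Rapid f) (hg : Rapid g) :
    opForm opH v f g = (∫ x, (inner ℝ (f x) (deriv g x) : ℝ)) + wedgePairing v f v g := by
  have hi : ∀ i j, Integrable fun x => (v x i * f x j) * Dinv (wedge v g i j) x := fun i j =>
    ((hv.coord i).mul (hf.coord j)).integrable_mul_Dinv (hv.wedge hg i j)
  have e : wedgePairing v f v g = ∫ x, ∑ i, ∑ j, (v x i * f x j) * Dinv (wedge v g i j) x := by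
    rw [integral_finsetSum _ fun i _ => integrable_finsetSum _ fun j _ => hi i j]
    refine Finset.sum_congr rfl fun i _ => ?_
    rw [integral_finsetSum _ fun j _ => hi i j]
    rfl
  rw [e, ← integral_add (hf.inner hg.deriv).integrable
    (integrable_finsetSum _ fun i _ => integrable_finsetSum _ fun j _ => hi i j)]
  refine integral_congr_ae (Eventually.of_forall fun x => ?_)
  simp only [opH_eq, inner_add_right]
  congr 1
  simp only [PiLp.inner_apply, RCLike.inner_apply, conj_trivial, contr_apply, Finset.sum_mul]
  rw [Finset.sum_comm]
  exact Finset.sum_congr rfl fun i _ => Finset.sum_congr rfl fun j _ => by ring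

/-- Skewness of the pairing moves the variation w out of D⁻¹ in the second term. Only the matrices
D⁻¹(v∧f) and D⁻¹(v∧g) remain, and these are what exactness controls. -/
theorem hasDerivAt_opForm_opH (v : 𝓢(ℝ, EV k)) (hw : Rapid w) (f g : 𝓢(ℝ, EV k)) :
    HasDerivAt (fun t : ℝ => opForm opH (⇑v + t • w) f g)
      (wedgePairing w f v g - wedgePairing w g v f) 0 := by
  obtain ⟨w, rfl⟩ := hw
  have hv := v.rapid
  have hw := w.rapid
  have hf := f.rapid
  have hg := g.rapid
  have e : ∀ t : ℝ, opForm opH (⇑v + t • ⇑w) f g = (∫ x, (inner ℝ (f x) (deriv g x) : ℝ))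
      + ∑ i, ∑ j, dinvPairing (fun x => v x i * f x j + t * (w x i * f x j))
        (fun x => wedge v g i j x + t * wedge w g i j x) := fun t => by
    refine (opForm_opH (v + t • w).rapid hf hg).trans ?_
    rw [wedgePairing]
    congr 1
    refine Finset.sum_congr rfl fun i _ => Finset.sum_congr rfl fun j _ => ?_
    congr 1 <;> ext x <;> simp [wedge] <;> ring
  rw [funext e, sub_eq_add_neg, ← wedgePairing_swap hv hf hw hg, wedgePairing, wedgePairing]
  simp only [← Finset.sum_add_distrib]
  refine HasDerivAt.const_add _ (HasDerivAt.fun_sum fun i _ => HasDerivAt.fun_sum fun j _ => ?_)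
  exact hasDerivAt_dinvPairing_line ((hv.coord i).mul (hf.coord j)) ((hw.coord i).mul (hf.coord j))
    (hv.wedge hg i j) (hw.wedge hg i j)

end Forms

/-! ## The Jacobi identity -/

section Jacobi

open Matrix

variable {k : ℕ}

theorem dotProduct_mulVec_of_skew {B : Matrix (Fin k) (Fin k) ℝ} (hB : Bᵀ = -B)
    (a b : Fin k → ℝ) : a ⬝ᵥ B *ᵥ b = -(b ⬝ᵥ B *ᵥ a) := by
  rw [dotProduct_comm, ← vecMul_transpose, ← dotProduct_mulVec, hB, neg_mulVec, dotProduct_neg]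

theorem dotProduct_mul_mulVec_of_skew {A B : Matrix (Fin k) (Fin k) ℝ} (hA : Aᵀ = -A)
    (hB : Bᵀ = -B) (a b : Fin k → ℝ) : a ⬝ᵥ (A * B) *ᵥ b = b ⬝ᵥ (B * A) *ᵥ a := by
  rw [dotProduct_comm, ← vecMul_transpose, ← dotProduct_mulVec, transpose_mul, hA, hB, neg_mul_neg]

theorem trace_vecMulVec_mul (a b : Fin k → ℝ) (M : Matrix (Fin k) (Fin k) ℝ) :
    trace (vecMulVec a b * M) = b ⬝ᵥ M *ᵥ a := by
  rw [vecMulVec_mul, trace_vecMulVec, dotProduct_comm, dotProduct_mulVec]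

/-- The algebraic identity behind the Jacobi identity of `H`. -/
theorem jacobi_density {X Y Z : Matrix (Fin k) (Fin k) ℝ} (hX : Xᵀ = -X) (hY : Yᵀ = -Y)
    (hZ : Zᵀ = -Z) (v ξ η ζ ξ' η' ζ' : Fin k → ℝ) :
    ((ζ' + v ᵥ* Z) ⬝ᵥ Y *ᵥ ξ - (ζ' + v ᵥ* Z) ⬝ᵥ X *ᵥ η)
      + ((ξ' + v ᵥ* X) ⬝ᵥ Z *ᵥ η - (ξ' + v ᵥ* X) ⬝ᵥ Y *ᵥ ζ)
      + ((η' + v ᵥ* Y) ⬝ᵥ X *ᵥ ζ - (η' + v ᵥ* Y) ⬝ᵥ Z *ᵥ ξ)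
    = (ζ' ⬝ᵥ Y *ᵥ ξ + ζ ⬝ᵥ (vecMulVec v η - vecMulVec η v) *ᵥ ξ + ζ ⬝ᵥ Y *ᵥ ξ')
      + (ξ' ⬝ᵥ Z *ᵥ η + ξ ⬝ᵥ (vecMulVec v ζ - vecMulVec ζ v) *ᵥ η + ξ ⬝ᵥ Z *ᵥ η')
      + (η' ⬝ᵥ X *ᵥ ζ + η ⬝ᵥ (vecMulVec v ξ - vecMulVec ξ v) *ᵥ ζ + η ⬝ᵥ X *ᵥ ζ')
      + trace ((vecMulVec v ξ - vecMulVec ξ v) * (Y * Z)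
        + X * ((vecMulVec v η - vecMulVec η v) * Z)
        + X * (Y * (vecMulVec v ζ - vecMulVec ζ v))) := by
  -- Cyclicity brings the differentiated factor to the front, where the trace against a rank-one
  -- matrix is a bilinear expression.
  have t2 : ∀ W : Matrix (Fin k) (Fin k) ℝ, trace (X * (W * Z)) = trace (W * (Z * X)) := fun W => by
    rw [trace_mul_comm, Matrix.mul_assoc]
  have t3 : ∀ W : Matrix (Fin k) (Fin k) ℝ, trace (X * (Y * W)) = trace (W * (X * Y)) := fun W => by
    rw [← Matrix.mul_assoc, trace_mul_comm]
  simp only [trace_add, t2, t3]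
  simp only [sub_mul, trace_sub, trace_vecMulVec_mul, add_dotProduct,
    ← dotProduct_mulVec, mulVec_mulVec, sub_mulVec, dotProduct_sub, vecMulVec_mulVec,
    dotProduct_smul, op_smul_eq_smul, smul_eq_mul]
  -- Skewness brings all terms to a common orientation. The trace terms match those containing v and
  -- two matrices; the products of two inner products, coming from X', Y', Z' between two covectors,
  -- cancel cyclically.
  rw [dotProduct_mulVec_of_skew hY ζ ξ', dotProduct_mulVec_of_skew hZ ξ η',
    dotProduct_mulVec_of_skew hX η ζ', dotProduct_mul_mulVec_of_skew hY hZ ξ v,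
    dotProduct_mul_mulVec_of_skew hZ hX η v, dotProduct_mul_mulVec_of_skew hX hY ζ v,
    dotProduct_comm ζ v, dotProduct_comm η v, dotProduct_comm ξ v, dotProduct_comm η ξ,
    dotProduct_comm ζ η, dotProduct_comm ξ ζ]
  ring

variable {v f g w : ℝ → EV k}

theorem dotProduct_mulVec_eq_sum (a b : EV k) (B : Fin k → Fin k → ℝ) :
    WithLp.ofLp a ⬝ᵥ Matrix.of B *ᵥ WithLp.ofLp b = ∑ i, ∑ j, a i * b j * B i j := by
  simp only [dotProduct, mulVec, Finset.mul_sum, Matrix.of_apply]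
  exact Finset.sum_congr rfl fun i _ => Finset.sum_congr rfl fun j _ => by ring

theorem trace_mul_mul_eq_sum (A B C : Fin k → Fin k → ℝ) :
    trace (Matrix.of A * (Matrix.of B * Matrix.of C)) = ∑ i, ∑ j, ∑ l, A i j * (B j l * C l i) := by
  simp [trace, Matrix.mul_apply, Finset.mul_sum]

theorem hasDerivAt_dotProduct_mulVec (hf : Rapid f) (hg : Rapid g) {B B' : Fin k → Fin k → ℝ → ℝ}
    {x : ℝ} (hB : ∀ i j, HasDerivAt (B i j) (B' i j x) x) :
    HasDerivAt (fun x => (f x).ofLp ⬝ᵥ (Matrix.of fun i j => B i j x) *ᵥ (g x).ofLp)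
      ((deriv f x).ofLp ⬝ᵥ (Matrix.of fun i j => B i j x) *ᵥ (g x).ofLp
        + (f x).ofLp ⬝ᵥ (Matrix.of fun i j => B' i j x) *ᵥ (g x).ofLp
        + (f x).ofLp ⬝ᵥ (Matrix.of fun i j => B i j x) *ᵥ (deriv g x).ofLp) x := by
  simp only [dotProduct_mulVec_eq_sum, ← Finset.sum_add_distrib]
  refine HasDerivAt.fun_sum fun i _ => HasDerivAt.fun_sum fun j _ => ?_
  exact (((hf.hasDerivAt_coord x i).fun_mul (hg.hasDerivAt_coord x j)).fun_mul (hB i j)).congr_deriv (by ring)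

theorem hasDerivAt_trace_mul_mul {A A' B B' C C' : Fin k → Fin k → ℝ → ℝ} {x : ℝ}
    (hA : ∀ i j, HasDerivAt (A i j) (A' i j x) x) (hB : ∀ i j, HasDerivAt (B i j) (B' i j x) x)
    (hC : ∀ i j, HasDerivAt (C i j) (C' i j x) x) :
    HasDerivAt (fun x => trace ((Matrix.of fun i j => A i j x)
        * ((Matrix.of fun i j => B i j x) * Matrix.of fun i j => C i j x)))
      (trace ((Matrix.of fun i j => A' i j x)
          * ((Matrix.of fun i j => B i j x) * Matrix.of fun i j => C i j x)
        + (Matrix.of fun i j => A i j x)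
          * ((Matrix.of fun i j => B' i j x) * Matrix.of fun i j => C i j x)
        + (Matrix.of fun i j => A i j x)
          * ((Matrix.of fun i j => B i j x) * Matrix.of fun i j => C' i j x))) x := by
  simp only [trace_add, trace_mul_mul_eq_sum, ← Finset.sum_add_distrib]
  refine HasDerivAt.fun_sum fun i _ => HasDerivAt.fun_sum fun j _ => HasDerivAt.fun_sum fun l _ => ?_
  exact ((hA i j).fun_mul ((hB j l).fun_mul (hC l i))).congr_deriv (by ring)

theorem of_wedge (v f : ℝ → EV k) (x : ℝ) : (Matrix.of fun i j => wedge v f i j x)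
    = vecMulVec (v x).ofLp (f x).ofLp - vecMulVec (f x).ofLp (v x).ofLp := by
  ext i j
  simp [wedge, vecMulVec_apply]

theorem rapid_dotProduct_mulVec (hf : Rapid f) (hg : Rapid g) {B : Fin k → Fin k → ℝ → ℝ}
    (hB : ∀ i j, Rapid (B i j)) :
    Rapid fun x => (f x).ofLp ⬝ᵥ (Matrix.of fun i j => B i j x) *ᵥ (g x).ofLp := by
  simp only [dotProduct_mulVec_eq_sum]
  exact Rapid.sum fun i => Rapid.sum fun j => ((hf.coord i).mul (hg.coord j)).mul (hB i j)

theorem rapid_trace_mul_mul {A B C : Fin k → Fin k → ℝ → ℝ} (hA : ∀ i j, Rapid (A i j))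
    (hB : ∀ i j, Rapid (B i j)) (hC : ∀ i j, Rapid (C i j)) :
    Rapid fun x => trace ((Matrix.of fun i j => A i j x)
        * ((Matrix.of fun i j => B i j x) * Matrix.of fun i j => C i j x)) := by
  simp only [trace_mul_mul_eq_sum]
  exact Rapid.sum fun i => Rapid.sum fun j => Rapid.sum fun l =>
    (hA i j).mul ((hB j l).mul (hC l i))

/-- A rapidly decreasing antiderivative of `v ∧ f` is `D⁻¹(v ∧ f)`. -/
theorem WedgeExact.rapid_Dinv (h : WedgeExact v f) (i j : Fin k) : Rapid (Dinv (wedge v f i j)) := by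
  obtain ⟨B, hB⟩ := h i j
  rw [B.rapid.Dinv_eq_of_hasDerivAt fun x => (hB x) ▸ B.rapid.hasDerivAt x]
  exact B.rapid

theorem transpose_Dinv_wedge (v f : ℝ → EV k) (x : ℝ) :
    (Matrix.of fun i j => Dinv (wedge v f i j) x)ᵀ = -Matrix.of fun i j => Dinv (wedge v f i j) x := by
  ext i j
  simp [wedge_swap v f i j, Dinv_neg]

theorem wedgePairing_eq_integral (hw : Rapid w) (hf : Rapid f) (hv : Rapid v) (hg : Rapid g) :
    wedgePairing w f v g
      = ∫ x, (w x).ofLp ⬝ᵥ (Matrix.of fun i j => Dinv (wedge v g i j) x) *ᵥ (f x).ofLp := by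
  have hi : ∀ i j, Integrable fun x => (w x i * f x j) * Dinv (wedge v g i j) x := fun i j =>
    ((hw.coord i).mul (hf.coord j)).integrable_mul_Dinv (hv.wedge hg i j)
  simp only [dotProduct_mulVec_eq_sum]
  rw [integral_finsetSum _ fun i _ => integrable_finsetSum _ fun j _ => hi i j]
  refine Finset.sum_congr rfl fun i _ => ?_
  rw [integral_finsetSum _ fun j _ => hi i j]
  rfl

theorem opH_ofLp (v f : ℝ → EV k) (x : ℝ) : (opH v f x).ofLp
    = (deriv f x).ofLp + (v x).ofLp ᵥ* Matrix.of fun i j => Dinv (wedge v f i j) x := by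
  ext j
  simp [opH_eq, vecMul, dotProduct]

theorem isHamiltonianOperator_opH : IsHamiltonianOperator (opH (k := k)) WedgeExact where
  linear := isLinearFamily_opH
  skew v f g := by
    rw [opForm_opH v.rapid f.rapid g.rapid, opForm_opH v.rapid g.rapid f.rapid,
      integral_inner_deriv f.rapid g.rapid,
      wedgePairing_swap v.rapid f.rapid v.rapid g.rapid]
    ring
  differentiable v f g ζ :=
    (hasDerivAt_opForm_opH v (v.rapid.opH ζ.rapid) f g).differentiableAt
  jacobi v ξ η ζ hξ hη hζ := by
    have rv := v.rapid
    have rξ := ξ.rapid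
    have rη := η.rapid
    have rζ := ζ.rapid
    have wξ := rv.opH rξ
    have wη := rv.opH rη
    have wζ := rv.opH rζ
    simp only [opFormDeriv, (hasDerivAt_opForm_opH v wξ _ _).deriv,
      (hasDerivAt_opForm_opH v wη _ _).deriv, (hasDerivAt_opForm_opH v wζ _ _).deriv]
    rw [wedgePairing_eq_integral wζ rξ rv rη, wedgePairing_eq_integral wζ rη rv rξ,
      wedgePairing_eq_integral wξ rη rv rζ, wedgePairing_eq_integral wξ rζ rv rη,
      wedgePairing_eq_integral wη rζ rv rξ, wedgePairing_eq_integral wη rξ rv rζ]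
    have i1 := rapid_dotProduct_mulVec wζ rξ hη.rapid_Dinv
    have i2 := rapid_dotProduct_mulVec wζ rη hξ.rapid_Dinv
    have i3 := rapid_dotProduct_mulVec wξ rη hζ.rapid_Dinv
    have i4 := rapid_dotProduct_mulVec wξ rζ hη.rapid_Dinv
    have i5 := rapid_dotProduct_mulVec wη rζ hξ.rapid_Dinv
    have i6 := rapid_dotProduct_mulVec wη rξ hζ.rapid_Dinv
    rw [← integral_sub i1.integrable i2.integrable, ← integral_sub i3.integrable i4.integrable,
      ← integral_sub i5.integrable i6.integrable,
      ← integral_add (i1.sub i2).integrable (i3.sub i4).integrable,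
      ← integral_add ((i1.sub i2).add (i3.sub i4)).integrable (i5.sub i6).integrable]
    -- The integrand is the derivative of ζ·Yξ + ξ·Zη + η·Xζ + tr(XYZ), which is rapidly decreasing
    -- by exactness.
    refine Rapid.integral_deriv_eq_zero
      ((((rapid_dotProduct_mulVec rζ rξ hη.rapid_Dinv).add
        (rapid_dotProduct_mulVec rξ rη hζ.rapid_Dinv)).add
        (rapid_dotProduct_mulVec rη rζ hξ.rapid_Dinv)).add
        (rapid_trace_mul_mul hξ.rapid_Dinv hη.rapid_Dinv hζ.rapid_Dinv)) fun x => ?_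
    have dB : ∀ (f : 𝓢(ℝ, EV k)) (i j : Fin k),
        HasDerivAt (Dinv (wedge v f i j)) (wedge v f i j x) x := fun f i j =>
      (rv.wedge f.rapid i j).hasDerivAt_Dinv x
    refine ((((hasDerivAt_dotProduct_mulVec rζ rξ (dB η)).fun_add
      (hasDerivAt_dotProduct_mulVec rξ rη (dB ζ))).fun_add
      (hasDerivAt_dotProduct_mulVec rη rζ (dB ξ))).fun_add
      (hasDerivAt_trace_mul_mul (dB ξ) (dB η) (dB ζ))).congr_deriv ?_
    simp only [of_wedge, opH_ofLp]
    exact (jacobi_density (transpose_Dinv_wedge _ _ x) (transpose_Dinv_wedge _ _ x)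
      (transpose_Dinv_wedge _ _ x) _ _ _ _ _ _ _).symm

end Jacobi

/-! ## The recursion operator is hereditary -/

section Hereditary

variable {k : ℕ} {v f g h w : ℝ → EV k}

theorem Rapid.const_mul {a : ℝ → ℝ} (c : ℝ) (ha : Rapid a) : Rapid fun x => c * a x :=
  ha.const_smul c

/-- The matrix `D⁻¹(v ∧ f)`. -/
noncomputable def wedgePrim (v f : ℝ → EV k) (x : ℝ) : Fin k → Fin k → ℝ :=
  fun i j => Dinv (wedge v f i j) x

/-- The value of `v ∧ f` at `x`. -/
def wedgeAt (v f : ℝ → EV k) (x : ℝ) : Fin k → Fin k → ℝ :=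
  fun i j => wedge v f i j x

/-- The derivative of `v ↦ J_v g` in the direction `h`. -/
noncomputable def opJDeriv (v h g : ℝ → EV k) (x : ℝ) : EV k :=
  Dinv (fun y => inner ℝ (h y) (g y)) x • v x + Dinv (fun y => inner ℝ (v y) (g y)) x • h x

theorem Rapid.opJDeriv (hv : Rapid v) (hh : Rapid h) (hg : Rapid g) : Rapid (opJDeriv v h g) :=
  (hv.smul (hh.hasTemperateGrowth_inner_Dinv hg)).add
    (hh.smul (hv.hasTemperateGrowth_inner_Dinv hg))

theorem opJ_line (hv : Rapid v) (hh : Rapid h) (hg : Rapid g) (t : ℝ) :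
    opJ (v + t • h) g = fun x => opJ v g x + t • opJDeriv v h g x
      + t ^ 2 • Dinv (fun y => inner ℝ (h y) (g y)) x • h x := by
  ext1 x
  have e : (fun y => inner ℝ ((v + t • h) y) (g y))
      = fun y => inner ℝ (v y) (g y) + t * inner ℝ (h y) (g y) := by
    ext y
    simp [inner_add_left, inner_smul_left]
  rw [opJ, e, Dinv_add (hv.inner hg).integrable ((hh.inner hg).integrable.const_mul t),
    Dinv_const_mul]
  simp only [opJ, opJDeriv, Pi.add_apply, Pi.smul_apply]
  module

theorem wedgePrim_line {w₀ w₁ w₂ : ℝ → EV k} (hv : Rapid v) (hh : Rapid h) (h₀ : Rapid w₀)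
    (h₁ : Rapid w₁) (h₂ : Rapid w₂) (t x : ℝ) :
    wedgePrim (v + t • h) (fun x => w₀ x + t • w₁ x + t ^ 2 • w₂ x) x
      = wedgePrim v w₀ x + t • (wedgePrim h w₀ x + wedgePrim v w₁ x)
        + t ^ 2 • (wedgePrim h w₁ x + wedgePrim v w₂ x) + t ^ 3 • wedgePrim h w₂ x := by
  ext i j
  have e : wedge (v + t • h) (fun x => w₀ x + t • w₁ x + t ^ 2 • w₂ x) i j
      = fun x => (wedge v w₀ i j x + t * (wedge h w₀ i j x + wedge v w₁ i j x))
        + (t ^ 2 * (wedge h w₁ i j x + wedge v w₂ i j x) + t ^ 3 * wedge h w₂ i j x) := by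
    ext x
    simp only [wedge, Pi.add_apply, Pi.smul_apply, PiLp.add_apply, PiLp.smul_apply, smul_eq_mul]
    ring
  have a0 := hv.wedge h₀ i j
  have a1 := (hh.wedge h₀ i j).add (hv.wedge h₁ i j)
  have a2 := (hh.wedge h₁ i j).add (hv.wedge h₂ i j)
  have a3 := hh.wedge h₂ i j
  simp only [wedgePrim, Pi.add_apply, Pi.smul_apply, smul_eq_mul]
  rw [e, Dinv_add (a0.add (a1.const_mul t)).integrable
    ((a2.const_mul (t ^ 2)).add (a3.const_mul (t ^ 3))).integrable,
    Dinv_add a0.integrable (a1.const_mul t).integrable,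
    Dinv_add (a2.const_mul (t ^ 2)).integrable (a3.const_mul (t ^ 3)).integrable,
    Dinv_const_mul, Dinv_const_mul, Dinv_const_mul,
    Dinv_add (hh.wedge h₀ i j).integrable (hv.wedge h₁ i j).integrable,
    Dinv_add (hh.wedge h₁ i j).integrable (hv.wedge h₂ i j).integrable]
  ring

theorem hasDerivAt_quartic {E : Type*} [NormedAddCommGroup E] [NormedSpace ℝ E]
    (p₀ p₁ p₂ p₃ p₄ : E) :
    HasDerivAt (fun t : ℝ => p₀ + t • p₁ + t ^ 2 • p₂ + t ^ 3 • p₃ + t ^ 4 • p₄) p₁ 0 := by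
  have hp : ∀ n : ℕ, HasDerivAt (fun t : ℝ => t ^ n) (n * 0 ^ (n - 1)) 0 := fun n => hasDerivAt_pow n 0
  have := (((((hasDerivAt_id (0 : ℝ)).smul_const p₁).const_add p₀).fun_add
    ((hp 2).smul_const p₂)).fun_add ((hp 3).smul_const p₃)).fun_add ((hp 4).smul_const p₄)
  simpa using this

/-- J is quadratic in v and H adds two more degrees, so R along the line is a quartic in t; its
linear coefficient is the derivative. -/
theorem hasDerivAt_opR (hv : Rapid v) (hh : Rapid h) (hg : Rapid g) (x : ℝ) :
    HasDerivAt (fun t : ℝ => opR (v + t • h) g x)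
      (deriv (opJDeriv v h g) x + contr (h x) (wedgePrim v (opJ v g) x)
        + contr (v x) (wedgePrim h (deriv g) x)) 0 := by
  have r₀ := hv.opJ hg
  have r₁ := hv.opJDeriv hh hg
  have r₂ := hh.smul (hh.hasTemperateGrowth_inner_Dinv hg)
  set w₀ := opJ v g with hw₀
  set w₁ := opJDeriv v h g with hw₁
  set w₂ := fun x => Dinv (fun y => inner ℝ (h y) (g y)) x • h x with hw₂
  have hd : ∀ t : ℝ, deriv (fun x => w₀ x + t • w₁ x + t ^ 2 • w₂ x) x
      = deriv w₀ x + t • deriv w₁ x + t ^ 2 • deriv w₂ x := fun t => by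
    rw [Rapid.deriv_add (r₀.add (r₁.const_smul t)) (r₂.const_smul (t ^ 2)),
      Rapid.deriv_add r₀ (r₁.const_smul t), r₁.deriv_smul, r₂.deriv_smul]
  have e : ∀ t : ℝ, opR (v + t • h) g x
      = (deriv w₀ x + contr (v x) (wedgePrim v w₀ x))
        + t • (deriv w₁ x + contr (h x) (wedgePrim v w₀ x)
            + contr (v x) (wedgePrim h w₀ x + wedgePrim v w₁ x))
        + t ^ 2 • (deriv w₂ x + contr (h x) (wedgePrim h w₀ x + wedgePrim v w₁ x)
            + contr (v x) (wedgePrim h w₁ x + wedgePrim v w₂ x))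
        + t ^ 3 • (contr (h x) (wedgePrim h w₁ x + wedgePrim v w₂ x)
            + contr (v x) (wedgePrim h w₂ x))
        + t ^ 4 • contr (h x) (wedgePrim h w₂ x) := fun t => by
    have h1 := wedgePrim_line hv hh r₀ r₁ r₂ t x
    rw [opR, opJ_line hv hh hg, opH_eq]
    change deriv (fun x => w₀ x + t • w₁ x + t ^ 2 • w₂ x) x
      + contr (v x + t • h x) (wedgePrim (v + t • h) (fun x => w₀ x + t • w₁ x + t ^ 2 • w₂ x) x) = _
    rw [h1, hd]
    simp only [contr_add_left, contr_smul_left, contr_add_right, contr_smul_right]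
    module
  -- The two terms with D⁻¹(v·g), namely h∧v and v∧h, cancel, and the term with D⁻¹(h·g) contains
  -- v∧v = 0.
  have hsum : wedgePrim h w₀ x + wedgePrim v w₁ x = wedgePrim h (deriv g) x := by
    ext i j
    simp only [Pi.add_apply, wedgePrim]
    rw [← Dinv_add (hh.wedge r₀ i j).integrable (hv.wedge r₁ i j).integrable]
    congr 1
    ext y
    simp only [hw₀, hw₁, wedge, opJ, opJDeriv, PiLp.add_apply, PiLp.smul_apply, smul_eq_mul]
    ring
  rw [funext e, ← hsum]
  exact hasDerivAt_quartic _ _ _ _ _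

theorem hasDerivAt_euclidean {F : ℝ → EV k} {F' : EV k} {x : ℝ}
    (hF : ∀ i, HasDerivAt (fun x => F x i) (F' i) x) : HasDerivAt F F' x :=
  HasFDerivAt.comp_hasDerivAt (f := fun x => (F x).ofLp) x
    (PiLp.hasFDerivAt_toLp (𝕜 := ℝ) 2 (F x).ofLp) (hasDerivAt_pi.2 hF)

theorem hasDerivAt_contr {B B' : ℝ → Fin k → Fin k → ℝ} (hf : Rapid f) {x : ℝ}
    (hB : ∀ i j, HasDerivAt (fun x => B x i j) (B' x i j) x) :
    HasDerivAt (fun x => contr (f x) (B x)) (contr (deriv f x) (B x) + contr (f x) (B' x)) x := by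
  refine hasDerivAt_euclidean fun j => ?_
  simp only [contr_apply, PiLp.add_apply, ← Finset.sum_add_distrib]
  exact HasDerivAt.fun_sum fun i _ => (hf.hasDerivAt_coord x i).fun_mul (hB i j)

theorem inner_contr_of_skew {B : Fin k → Fin k → ℝ} (hB : ∀ i j, B j i = -B i j) (a b : EV k) :
    (inner ℝ (contr a B) b : ℝ) = -inner ℝ a (contr b B) := by
  simp only [PiLp.inner_apply, RCLike.inner_apply, conj_trivial, contr_apply, Finset.sum_mul,
    Finset.mul_sum, ← Finset.sum_neg_distrib]
  rw [Finset.sum_comm]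
  refine Finset.sum_congr rfl fun i _ => Finset.sum_congr rfl fun j _ => ?_
  rw [hB i j]
  ring

/-- The product of two matrices. -/
def matProd (A B : Fin k → Fin k → ℝ) : Fin k → Fin k → ℝ := fun i j => ∑ l, A i l * B l j

theorem contr_matProd (u : EV k) (A B : Fin k → Fin k → ℝ) :
    contr u (matProd A B) = contr (contr u A) B := by
  ext j
  simp only [contr_apply, matProd, Finset.mul_sum, Finset.sum_mul]
  rw [Finset.sum_comm]
  simp only [mul_assoc]

/-- The commutator with a skew matrix acts on u∧w as a derivation: [u∧w, B] = u∧(w⌋B) + (u⌋B)∧w. -/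
theorem matProd_wedge_comm {B : Fin k → Fin k → ℝ} (hB : ∀ i j, B j i = -B i j) (u w : EV k)
    (i j : Fin k) :
    matProd (fun i j => u i * w j - w i * u j) B i j - matProd B (fun i j => u i * w j - w i * u j) i j
      = u i * contr w B j - contr w B i * u j + (contr u B i * w j - w i * contr u B j) := by
  simp only [matProd, contr_apply, Finset.mul_sum, Finset.sum_mul, ← Finset.sum_sub_distrib,
    ← Finset.sum_add_distrib]
  refine Finset.sum_congr rfl fun l _ => ?_
  rw [hB l i]
  ring

theorem wedgePrim_skew (v f : ℝ → EV k) (x : ℝ) (i j : Fin k) :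
    wedgePrim v f x j i = -wedgePrim v f x i j := by
  simp [wedgePrim, wedge_swap v f i j, Dinv_neg]

/-- Only the difference needs a rapidly decreasing antiderivative; neither wedge product is assumed
to be exact by itself. -/
theorem wedgePrim_sub_eq {a b c d : ℝ → EV k} (ha : Rapid a) (hb : Rapid b) (hc : Rapid c)
    (hd : Rapid d) {A : ℝ → Fin k → Fin k → ℝ} (hA : ∀ i j, Rapid fun x => A x i j)
    (hA' : ∀ i j x, HasDerivAt (fun x => A x i j) (wedge a b i j x - wedge c d i j x) x) (x : ℝ) :
    wedgePrim a b x - wedgePrim c d x = A x := by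
  ext i j
  simp only [Pi.sub_apply, wedgePrim]
  rw [← Dinv_sub (ha.wedge hb i j).integrable (hc.wedge hd i j).integrable,
    (hA i j).Dinv_eq_of_hasDerivAt (hA' i j)]

theorem hasDerivAt_inner_Dinv (hv : Rapid v) (hf : Rapid f) (x : ℝ) :
    HasDerivAt (Dinv fun y => inner ℝ (v y) (f y)) (inner ℝ (v x) (f x)) x :=
  (hv.inner hf).hasDerivAt_Dinv x

theorem hasDerivAt_opJDeriv (hv : Rapid v) (hh : Rapid h) (hg : Rapid g) (x : ℝ) :
    HasDerivAt (opJDeriv v h g)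
      (Dinv (fun y => inner ℝ (h y) (g y)) x • deriv v x + (inner ℝ (h x) (g x) : ℝ) • v x
        + (Dinv (fun y => inner ℝ (v y) (g y)) x • deriv h x
          + (inner ℝ (v x) (g x) : ℝ) • h x)) x :=
  ((hasDerivAt_inner_Dinv hh hg x).fun_smul (hv.hasDerivAt x)).fun_add
    ((hasDerivAt_inner_Dinv hv hg x).fun_smul (hh.hasDerivAt x))

theorem deriv_opJ (hv : Rapid v) (hf : Rapid f) (x : ℝ) :
    deriv (opJ v f) x = deriv (deriv f) x
      + (Dinv (fun y => inner ℝ (v y) (f y)) x • deriv v x + (inner ℝ (v x) (f x) : ℝ) • v x) :=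
  ((hf.deriv.hasDerivAt x).fun_add
    ((hasDerivAt_inner_Dinv hv hf x).fun_smul (hv.hasDerivAt x))).deriv

theorem hasDerivAt_wedge (hf : Rapid f) (hg : Rapid g) (i j : Fin k) (x : ℝ) :
    HasDerivAt (wedge f g i j) (wedge (deriv f) g i j x - wedge (deriv g) f i j x) x := by
  refine (((hf.hasDerivAt_coord x i).fun_mul (hg.hasDerivAt_coord x j)).fun_sub
    ((hg.hasDerivAt_coord x i).fun_mul (hf.hasDerivAt_coord x j))).congr_deriv ?_
  simp only [wedge]
  ring

/-- `R'[f] g - R'[g] f`. -/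
theorem opR_commutator (hv : Rapid v) (hf : Rapid f) (hg : Rapid g) (x : ℝ) :
    opDeriv opR v f g x - opDeriv opR v g f x
      = Dinv (fun y => inner ℝ (v y) (g y)) x • deriv f x
        - Dinv (fun y => inner ℝ (v y) (f y)) x • deriv g x
        + contr (f x) (wedgePrim v (opJ v g) x) - contr (g x) (wedgePrim v (opJ v f) x) := by
  -- Since (f∧g)' = f∧g' - g∧f' and f∧g decays, the nonlocal terms collapse to a local one without
  -- any exactness assumption.
  have h1 : wedgePrim f (deriv g) x - wedgePrim g (deriv f) x = wedgeAt f g x := by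
    refine wedgePrim_sub_eq hf hg.deriv hg hf.deriv (fun i j => hf.wedge hg i j) (fun i j x => ?_) x
    refine (hasDerivAt_wedge hf hg i j x).congr_deriv ?_
    simp only [wedge]
    ring
  have h2 : contr (v x) (wedgePrim f (deriv g) x) - contr (v x) (wedgePrim g (deriv f) x)
      = (inner ℝ (v x) (f x) : ℝ) • g x - (inner ℝ (v x) (g x) : ℝ) • f x := by
    rw [← contr_sub_right, h1]
    exact contr_wedge v f g x
  have h3 : (fun y => (inner ℝ (g y) (f y) : ℝ)) = fun y => inner ℝ (f y) (g y) :=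
    funext fun y => real_inner_comm _ _
  have h4 : ∀ a b c d e f' : EV k, a + b + c - (d + e + f') = a - d + b - e + (c - f') := by
    intros; abel
  rw [opDeriv, opDeriv, (hasDerivAt_opR hv hf hg x).deriv, (hasDerivAt_opR hv hg hf x).deriv, h4, h2,
    (hasDerivAt_opJDeriv hv hf hg x).deriv, (hasDerivAt_opJDeriv hv hg hf x).deriv, h3,
    real_inner_comm (g x) (f x)]
  module

end Hereditary

/-! ### The Nijenhuis torsion of the recursion operator -/

section Torsion

variable {k : ℕ} {v f g h w : ℝ → EV k}

theorem rapid_contr_wedgePrim (hw : Rapid w) (hv : Rapid v) (hf : Rapid f) :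
    Rapid fun x => contr (w x) (wedgePrim v f x) :=
  hw.contr fun i j => (hv.wedge hf i j).hasTemperateGrowth_Dinv

theorem hasDerivAt_contr_wedgePrim (hw : Rapid w) (hv : Rapid v) (hf : Rapid f) (x : ℝ) :
    HasDerivAt (fun x => contr (w x) (wedgePrim v f x))
      (contr (deriv w x) (wedgePrim v f x)
        + ((inner ℝ (w x) (v x) : ℝ) • f x - (inner ℝ (w x) (f x) : ℝ) • v x)) x := by
  rw [← contr_wedge w v f x]
  exact hasDerivAt_contr (B := wedgePrim v f) (B' := wedgeAt v f) hw fun i j => (hv.wedge hf i j).hasDerivAt_Dinv x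

theorem opR_eq (v f : ℝ → EV k) (x : ℝ) :
    opR v f x = deriv (opJ v f) x + contr (v x) (wedgePrim v (opJ v f) x) := rfl

/-- `R'[f] g - R'[g] f`, in closed form. -/
noncomputable def opRComm (v f g : ℝ → EV k) (x : ℝ) : EV k :=
  Dinv (fun y => inner ℝ (v y) (g y)) x • deriv f x
    - Dinv (fun y => inner ℝ (v y) (f y)) x • deriv g x
    + contr (f x) (wedgePrim v (opJ v g) x) - contr (g x) (wedgePrim v (opJ v f) x)

theorem Rapid.opRComm (hv : Rapid v) (hf : Rapid f) (hg : Rapid g) : Rapid (opRComm v f g) :=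
  (((hf.deriv.smul (hv.hasTemperateGrowth_inner_Dinv hg)).sub
    (hg.deriv.smul (hv.hasTemperateGrowth_inner_Dinv hf))).add
    (rapid_contr_wedgePrim hf hv (hv.opJ hg))).sub (rapid_contr_wedgePrim hg hv (hv.opJ hf))

/-- The second derivatives of f and g combine with other terms into Rf and Rg, because the terms
with the derivative of v cancel in D⁻¹(v·g)Rf - D⁻¹(v·f)Rg. -/
theorem deriv_opRComm (hv : Rapid v) (hf : Rapid f) (hg : Rapid g) (x : ℝ) :
    deriv (opRComm v f g) x
      = (inner ℝ (opJ v f x) (g x) - inner ℝ (opJ v g x) (f x) : ℝ) • v x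
        + Dinv (fun y => inner ℝ (v y) (g y)) x • opR v f x
        - Dinv (fun y => inner ℝ (v y) (f y)) x • opR v g x
        - (contr (opJ v g x) (wedgePrim v (opJ v f) x)
          - contr (opJ v f x) (wedgePrim v (opJ v g) x)) := by
  have h1 : HasDerivAt (opRComm v f g) _ x :=
    (((((hasDerivAt_inner_Dinv hv hg x).fun_smul (hf.deriv.hasDerivAt x)).fun_sub
    ((hasDerivAt_inner_Dinv hv hf x).fun_smul (hg.deriv.hasDerivAt x))).fun_add
    (hasDerivAt_contr_wedgePrim hf hv (hv.opJ hg) x)).fun_sub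
    (hasDerivAt_contr_wedgePrim hg hv (hv.opJ hf) x))
  rw [h1.deriv, opR_eq, opR_eq, deriv_opJ hv hf, deriv_opJ hv hg]
  rw [real_inner_comm (opJ v f x) (g x), real_inner_comm (opJ v g x) (f x), real_inner_comm (v x) (f x),
    real_inner_comm (v x) (g x)]
  have e : ∀ f B, contr (opJ v f x) B
      = contr (deriv f x) B + Dinv (fun y => inner ℝ (v y) (f y)) x • contr (v x) B := fun f B => by
    rw [opJ, contr_add_left, contr_smul_left]
  rw [e f, e g]
  have e' : ∀ f, opJ v f x = deriv f x + Dinv (fun y => inner ℝ (v y) (f y)) x • v x := fun f => rfl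
  generalize (inner ℝ (f x) (opJ v g x) : ℝ) = c₁
  generalize (inner ℝ (g x) (opJ v f x) : ℝ) = c₂
  rw [e' f, e' g]
  module

/-- Jf·g - Jg·f is rapidly decreasing with derivative Rf·g - Rg·f - v·K: the terms with B_f and B_g
drop out because these matrices are skew. -/
theorem Dinv_inner_opR_sub (hv : Rapid v) (hf : Rapid f) (hg : Rapid g) (x : ℝ) :
    Dinv (fun y => inner ℝ (opR v f y) (g y)) x - Dinv (fun y => inner ℝ (opR v g y) (f y)) x
      = (inner ℝ (opJ v f x) (g x) - inner ℝ (opJ v g x) (f x))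
        + Dinv (fun y => inner ℝ (v y) (opRComm v f g y)) x := by
  have r₁ := (hv.opR hf).inner hg
  have r₂ := (hv.opR hg).inner hf
  have r₃ := hv.inner (hv.opRComm hf hg)
  have rE := ((hv.opJ hf).inner hg).sub ((hv.opJ hg).inner hf)
  have h : Dinv (fun y => inner ℝ (opR v f y) (g y) - inner ℝ (opR v g y) (f y)
      - inner ℝ (v y) (opRComm v f g y))
      = fun x => (inner ℝ (opJ v f x) (g x) - inner ℝ (opJ v g x) (f x) : ℝ) := by
    refine rE.Dinv_eq_of_hasDerivAt fun y => ?_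
    refine ((((hv.opJ hf).hasDerivAt y).inner ℝ (hg.hasDerivAt y)).fun_sub
      (((hv.opJ hg).hasDerivAt y).inner ℝ (hf.hasDerivAt y))).congr_deriv ?_
    simp only [opR_eq, opRComm, inner_add_left, inner_add_right, inner_sub_right, inner_smul_right,
      inner_contr_of_skew (wedgePrim_skew v _ y)]
    have e : ∀ f w : EV k, ∀ c : ℝ, (inner ℝ (f + c • v y) w : ℝ) = inner ℝ f w + c * inner ℝ (v y) w :=
      fun f w c => by rw [inner_add_left, real_inner_smul_left]
    have e' : ∀ f, opJ v f y = deriv f y + Dinv (fun y => inner ℝ (v y) (f y)) y • v y := fun f => rfl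
    rw [e' f, e' g, e, e, real_inner_comm (deriv f y)]
    ring
  have h2 := congrFun h x
  rw [Dinv_sub (r₁.sub r₂).integrable r₃.integrable, Dinv_sub r₁.integrable r₂.integrable] at h2
  linarith

/-- The right-hand side is an antiderivative of the undifferentiated left-hand side. The commutator
of B_f and B_g absorbs the terms in which the contractions with them are wedged with v, Jf or Jg. -/
theorem wedgePrim_identity (hv : Rapid v) (hf : Rapid f) (hg : Rapid g)
    (ef : WedgeExact v (opJ v f)) (eg : WedgeExact v (opJ v g)) (x : ℝ) :
    wedgePrim (opR v f) (deriv g) x - wedgePrim (opR v g) (deriv f) x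
        - wedgePrim v (opJ v (opRComm v f g)) x
      = wedgeAt (opJ v f) (opJ v g) x
        - (matProd (wedgePrim v (opJ v f) x) (wedgePrim v (opJ v g) x)
          - matProd (wedgePrim v (opJ v g) x) (wedgePrim v (opJ v f) x)) := by
  have rK := hv.opRComm hf hg
  have rf := hv.opJ hf
  have rg := hv.opJ hg
  have rRf := hv.opR hf
  have rRg := hv.opR hg
  have rB : ∀ {f}, WedgeExact v f → ∀ i j, Rapid fun x => wedgePrim v f x i j :=
    fun e i j => e.rapid_Dinv i j
  have dB : ∀ {f}, Rapid f → ∀ i j x, HasDerivAt (fun x => wedgePrim v f x i j) (wedge v f i j x) x :=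
    fun hf i j x => (hv.wedge hf i j).hasDerivAt_Dinv x
  ext i j
  -- Exactness is needed here: without it the commutator of B_f and B_g could have nonzero limits.
  have hN : Rapid fun x => wedge (opJ v f) (opJ v g) i j x
      - (matProd (wedgePrim v (opJ v f) x) (wedgePrim v (opJ v g) x) i j
        - matProd (wedgePrim v (opJ v g) x) (wedgePrim v (opJ v f) x) i j) :=
    (rf.wedge rg i j).sub ((Rapid.sum fun l => (rB ef i l).mul (rB eg l j)).sub
      (Rapid.sum fun l => (rB eg i l).mul (rB ef l j)))
  have hN' : ∀ x, HasDerivAt (fun x => wedge (opJ v f) (opJ v g) i j x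
      - (matProd (wedgePrim v (opJ v f) x) (wedgePrim v (opJ v g) x) i j
        - matProd (wedgePrim v (opJ v g) x) (wedgePrim v (opJ v f) x) i j))
      (wedge (opR v f) (deriv g) i j x - wedge (opR v g) (deriv f) i j x
        - wedge v (opJ v (opRComm v f g)) i j x) x := fun x => by
    refine ((hasDerivAt_wedge rf rg i j x).fun_sub
      ((HasDerivAt.fun_sum fun l _ => (dB rf i l x).fun_mul (dB rg l j x)).fun_sub
      (HasDerivAt.fun_sum fun l _ => (dB rg i l x).fun_mul (dB rf l j x)))).congr_deriv ?_
    -- The derivative of [B_f, B_g] is [v∧Jf, B_g] - [v∧Jg, B_f], and both brackets are expanded by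
    -- the derivation rule.
    have m₁ := matProd_wedge_comm (wedgePrim_skew v (opJ v g) x) (v x) (opJ v f x) i j
    have m₂ := matProd_wedge_comm (wedgePrim_skew v (opJ v f) x) (v x) (opJ v g x) i j
    simp only [matProd] at m₁ m₂
    simp only [Finset.sum_add_distrib]
    have hJK : opJ v (opRComm v f g) x = deriv (opRComm v f g) x
      + Dinv (fun y => inner ℝ (v y) (opRComm v f g y)) x • v x := rfl
    have hf' : deriv f x = opJ v f x - Dinv (fun y => inner ℝ (v y) (f y)) x • v x := by simp [opJ]
    have hg' : deriv g x = opJ v g x - Dinv (fun y => inner ℝ (v y) (g y)) x • v x := by simp [opJ]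
    rw [deriv_opRComm hv hf hg] at hJK
    simp only [wedge, hJK, hf', hg', opR_eq, PiLp.add_apply, PiLp.sub_apply, PiLp.smul_apply,
      smul_eq_mul] at m₁ m₂ ⊢
    linear_combination m₂ - m₁
  have h := congrFun (hN.Dinv_eq_of_hasDerivAt hN') x
  rw [Dinv_sub ((rRf.wedge hg.deriv i j).sub (rRg.wedge hf.deriv i j)).integrable
    (hv.wedge (hv.opJ rK) i j).integrable, Dinv_sub (rRf.wedge hg.deriv i j).integrable
    (rRg.wedge hf.deriv i j).integrable] at h
  exact h

/-- After inserting the formula for R', the part under D reduces to JK and local corrections, the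
part under v⌋D⁻¹ to v⌋(v∧JK)-type terms and the commutator; RK removes JK from both, and the rest
cancels through Rf = (Jf)' + v⌋B_f. -/
theorem opR_torsion (hv : Rapid v) (hf : Rapid f) (hg : Rapid g)
    (ef : WedgeExact v (opJ v f)) (eg : WedgeExact v (opJ v g)) (x : ℝ) :
    opDeriv opR v (opR v f) g x - opDeriv opR v (opR v g) f x - opR v (opRComm v f g) x = 0 := by
  have rK := hv.opRComm hf hg
  have rRf := hv.opR hf
  have rRg := hv.opR hg
  have rM := (rapid_contr_wedgePrim (hv.opJ hg) hv (hv.opJ hf)).sub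
    (rapid_contr_wedgePrim (hv.opJ hf) hv (hv.opJ hg))
  -- The coefficient of v on the left is D⁻¹(Rf·g) - D⁻¹(Rg·f); trading it for D⁻¹(v·K) is what
  -- produces JK.
  have hS : (fun x => opJDeriv v (opR v f) g x - opJDeriv v (opR v g) f x)
      = fun x => opJ v (opRComm v f g) x + (contr (opJ v g x) (wedgePrim v (opJ v f) x)
          - contr (opJ v f x) (wedgePrim v (opJ v g) x)) := by
    ext1 y
    have h := Dinv_inner_opR_sub hv hf hg y
    rw [sub_eq_iff_eq_add] at h
    rw [opJDeriv, opJDeriv, opJ, deriv_opRComm hv hf hg, h]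
    module
  have hS' := congrArg (fun F => deriv F x) hS
  have dM := ((hasDerivAt_contr_wedgePrim (hv.opJ hg) hv (hv.opJ hf) x).fun_sub
    (hasDerivAt_contr_wedgePrim (hv.opJ hf) hv (hv.opJ hg) x))
  simp only [((((hv.opJDeriv rRf hg).hasDerivAt x).fun_sub
    ((hv.opJDeriv rRg hf).hasDerivAt x))).deriv, Rapid.deriv_add (hv.opJ rK) rM, dM.deriv] at hS'
  have hW := congrArg (contr (v x)) (wedgePrim_identity hv hf hg ef eg x)
  have hc : contr (v x) (wedgeAt (opJ v f) (opJ v g) x) = _ := contr_wedge v _ _ x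
  simp only [contr_sub_right, contr_matProd, hc] at hW
  rw [opDeriv, opDeriv, (hasDerivAt_opR hv rRf hg x).deriv, (hasDerivAt_opR hv rRg hf x).deriv,
    opR_eq v (opRComm v f g)]
  have e : ∀ f B, contr (opR v f x) B = contr (deriv (opJ v f) x) B
      + contr (contr (v x) (wedgePrim v (opJ v f) x)) B := fun f B => by
    rw [opR_eq, contr_add_left]
  rw [e, e]
  rw [sub_eq_iff_eq_add] at hS'
  rw [hS']
  rw [sub_eq_iff_eq_add, sub_eq_iff_eq_add] at hW
  rw [hW, real_inner_comm (opJ v g x) (v x), real_inner_comm (opJ v f x) (v x),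
    real_inner_comm (opJ v g x) (opJ v f x)]
  module

theorem isHereditary_opR :
    IsHereditary (opR (k := k)) (fun v f => WedgeExact v (opJ v f)) where
  linear := isLinearFamily_opR
  differentiable v h f x := (hasDerivAt_opR v.rapid h.rapid f.rapid x).differentiableAt
  torsion_eq_zero v f g ef eg x := by
    rw [funext (opR_commutator v.rapid f.rapid g.rapid)]
    exact opR_torsion v.rapid f.rapid g.rapid ef eg x

end Torsion

/-! ## Covariant derivatives along maps, in coordinates -/

section CovDer

variable {S E F : Type*} [NormedAddCommGroup S] [NormedSpace ℝ S] [NormedAddCommGroup E]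
  [NormedSpace ℝ E] [NormedAddCommGroup F] [NormedSpace ℝ F]

/-- Covariant derivative of a field `Z` along `u`, with connection form `Γ`. -/
noncomputable def covDer (Γ : E → E →L[ℝ] F →L[ℝ] F) (u : S → E) (Z : S → F) (s w : S) : F :=
  fderiv ℝ Z s w + Γ (u s) (fderiv ℝ u s w) (Z s)

variable {Γ : E → E →L[ℝ] F →L[ℝ] F} {G : E → F →L[ℝ] F →L[ℝ] ℝ} {θ : E → E →L[ℝ] F} {u : S → E}
  {Z A B : S → F} {s : S}

theorem ContDiffAt.fderiv_apply_const {H : Type*} [NormedAddCommGroup H] [NormedSpace ℝ H]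
    {f : S → H} (hf : ContDiffAt ℝ ∞ f s) (w : S) : ContDiffAt ℝ ∞ (fun s => fderiv ℝ f s w) s :=
  (hf.fderiv_right (m := ∞) (by simp)).clm_apply contDiffAt_const

theorem contDiffAt_covDer (hΓ : ContDiffAt ℝ ∞ Γ (u s)) (hu : ContDiffAt ℝ ∞ u s)
    (hZ : ContDiffAt ℝ ∞ Z s) (w : S) : ContDiffAt ℝ ∞ (fun s => covDer Γ u Z s w) s :=
  (hZ.fderiv_apply_const w).add
    (((hΓ.comp s hu).clm_apply (hu.fderiv_apply_const w)).clm_apply hZ)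

theorem contDiffAt_metric (hG : ContDiffAt ℝ ∞ G (u s)) (hu : ContDiffAt ℝ ∞ u s)
    (hA : ContDiffAt ℝ ∞ A s) (hB : ContDiffAt ℝ ∞ B s) :
    ContDiffAt ℝ ∞ (fun s => G (u s) (A s) (B s)) s :=
  ((hG.comp s hu).clm_apply hA).clm_apply hB

/-- Product rule for a metric connection. -/
theorem fderiv_metric (hG : DifferentiableAt ℝ G (u s)) (hu : DifferentiableAt ℝ u s)
    (hA : DifferentiableAt ℝ A s) (hB : DifferentiableAt ℝ B s)
    (hc : ∀ (w : E) (Y Z : F), fderiv ℝ (fun u' => G u' Y Z) (u s) w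
      = G (u s) (Γ (u s) w Y) Z + G (u s) Y (Γ (u s) w Z)) (w : S) :
    fderiv ℝ (fun s => G (u s) (A s) (B s)) s w
      = G (u s) (covDer Γ u A s w) (B s) + G (u s) (A s) (covDer Γ u B s w) := by
  have hGu : HasFDerivAt (fun s => G (u s)) ((fderiv ℝ G (u s)).comp (fderiv ℝ u s)) s :=
    HasFDerivAt.comp (g := G) s hG.hasFDerivAt hu.hasFDerivAt
  have h1 := (hGu.clm_apply hA.hasFDerivAt).clm_apply hB.hasFDerivAt
  -- Compatibility is stated for constant Y, Z; it is rewritten for the derivative of G itself and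
  -- then used at Y = A(s), Z = B(s).
  have h2 : ∀ Y Z : F, fderiv ℝ (fun u' => G u' Y Z) (u s) (fderiv ℝ u s w)
      = fderiv ℝ G (u s) (fderiv ℝ u s w) Y Z := fun Y Z => by
    rw [((hG.hasFDerivAt.clm_apply (hasFDerivAt_const Y _)).clm_apply
      (hasFDerivAt_const Z _)).fderiv]
    simp
  have h3 := hc (fderiv ℝ u s w) (A s) (B s)
  rw [h2] at h3
  have h4 : fderiv ℝ (fun s => G (u s) (A s) (B s)) s w
      = G (u s) (A s) (fderiv ℝ B s w) + (G (u s) (fderiv ℝ A s w) (B s)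
        + fderiv ℝ G (u s) (fderiv ℝ u s w) (A s) (B s)) := by
    refine (congrArg (fun L => L w) h1.fderiv).trans ?_
    simp
  rw [h4, h3]
  simp only [covDer, map_add, add_apply]
  ring

theorem fderiv_fderiv_comm {H : Type*} [NormedAddCommGroup H] [NormedSpace ℝ H] {f : S → H}
    (hf : ContDiffAt ℝ ∞ f s) (a b : S) :
    fderiv ℝ (fderiv ℝ f) s a b = fderiv ℝ (fderiv ℝ f) s b a :=
  hf.isSymmSndFDerivAt (by
    rw [minSmoothness_of_isRCLikeNormedField]
    exact WithTop.coe_le_coe.2 (le_top (a := (2 : ℕ∞)))) a b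

theorem hasFDerivAt_fderiv {H : Type*} [NormedAddCommGroup H] [NormedSpace ℝ H] {f : S → H}
    (hf : ContDiffAt ℝ ∞ f s) : HasFDerivAt (fderiv ℝ f) (fderiv ℝ (fderiv ℝ f) s) s :=
  ((hf.fderiv_right (m := ∞) (by simp)).differentiableAt (by simp)).hasFDerivAt

/-- The commutator of covariant derivatives is the curvature `dΓ + Γ ∧ Γ`. -/
theorem covDer_covDer_sub (hΓ : DifferentiableAt ℝ Γ (u s)) (hu : ContDiffAt ℝ ∞ u s)
    (hZ : ContDiffAt ℝ ∞ Z s) (a b : S) :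
    covDer Γ u (fun s => covDer Γ u Z s b) s a - covDer Γ u (fun s => covDer Γ u Z s a) s b
      = fderiv ℝ Γ (u s) (fderiv ℝ u s a) (fderiv ℝ u s b) (Z s)
        - fderiv ℝ Γ (u s) (fderiv ℝ u s b) (fderiv ℝ u s a) (Z s)
        + Γ (u s) (fderiv ℝ u s a) (Γ (u s) (fderiv ℝ u s b) (Z s))
        - Γ (u s) (fderiv ℝ u s b) (Γ (u s) (fderiv ℝ u s a) (Z s)) := by
  have hu' := (hu.differentiableAt (by simp)).hasFDerivAt
  have hZ' := (hZ.differentiableAt (by simp)).hasFDerivAt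
  have key : ∀ a b : S, fderiv ℝ (fun s => covDer Γ u Z s b) s a
      = fderiv ℝ (fderiv ℝ Z) s a b + (Γ (u s) (fderiv ℝ u s b) (fderiv ℝ Z s a)
        + (Γ (u s) (fderiv ℝ (fderiv ℝ u) s a b) (Z s)
          + fderiv ℝ Γ (u s) (fderiv ℝ u s a) (fderiv ℝ u s b) (Z s))) := fun a b => by
    have h := ((hasFDerivAt_fderiv hZ).clm_apply (hasFDerivAt_const b s)).add
      (((hΓ.hasFDerivAt.comp s hu').clm_apply
        ((hasFDerivAt_fderiv hu).clm_apply (hasFDerivAt_const b s))).clm_apply hZ')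
    refine (congrArg (fun L => L a) h.fderiv).trans ?_
    simp
  have e : ∀ a b : S, covDer Γ u (fun s => covDer Γ u Z s b) s a
      = fderiv ℝ (fun s => covDer Γ u Z s b) s a
        + Γ (u s) (fderiv ℝ u s a) (fderiv ℝ Z s b + Γ (u s) (fderiv ℝ u s b) (Z s)) := fun _ _ => rfl
  -- The second derivatives of Z and u, and the mixed terms Γ(∂u)∂Z, are symmetric in a, b and
  -- cancel.
  rw [e, e, key a b, key b a, fderiv_fderiv_comm hZ a b, fderiv_fderiv_comm hu a b]
  simp only [map_add]
  abel

/-- The torsion `dθ + Γ ∧ θ` evaluated on the velocities of `u`. -/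
theorem covDer_coframe_sub (hθ : DifferentiableAt ℝ θ (u s)) (hu : ContDiffAt ℝ ∞ u s) (a b : S) :
    covDer Γ u (fun s => θ (u s) (fderiv ℝ u s b)) s a
        - covDer Γ u (fun s => θ (u s) (fderiv ℝ u s a)) s b
      = fderiv ℝ θ (u s) (fderiv ℝ u s a) (fderiv ℝ u s b)
        - fderiv ℝ θ (u s) (fderiv ℝ u s b) (fderiv ℝ u s a)
        + Γ (u s) (fderiv ℝ u s a) (θ (u s) (fderiv ℝ u s b))
        - Γ (u s) (fderiv ℝ u s b) (θ (u s) (fderiv ℝ u s a)) := by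
  have hu' := (hu.differentiableAt (by simp)).hasFDerivAt
  have key : ∀ a b : S, fderiv ℝ (fun s => θ (u s) (fderiv ℝ u s b)) s a
      = θ (u s) (fderiv ℝ (fderiv ℝ u) s a b)
        + fderiv ℝ θ (u s) (fderiv ℝ u s a) (fderiv ℝ u s b) := fun a b => by
    have h := (hθ.hasFDerivAt.comp s hu').clm_apply
        ((hasFDerivAt_fderiv hu).clm_apply (hasFDerivAt_const b s))
    refine (congrArg (fun L => L a) h.fderiv).trans ?_
    simp
  rw [covDer, covDer, key a b, key b a, fderiv_fderiv_comm hu a b]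
  abel

end CovDer

/-! ## Orthonormal frames of a symmetric bilinear form -/

/-- The r vectors have the identity as Gram matrix, so they form a basis; Y is expanded in it with
coefficients G(Y, e_a). -/
theorem apply_eq_sum_of_orthonormal {r : ℕ} {G : EV r →L[ℝ] EV r →L[ℝ] ℝ}
    {e : Fin r → EV r} (he : ∀ a b, G (e a) (e b) = if a = b then 1 else 0)
    (X Y : EV r) : G X Y = ∑ a, G X (e a) * G Y (e a) := by
  have hli : LinearIndependent ℝ e := by
    rw [Fintype.linearIndependent_iff]
    intro c hc a
    have h : G (∑ b, c b • e b) (e a) = c a := by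
      simp [map_sum, he]
    rw [hc] at h
    simpa using h.symm
  have hspan : ∀ W : EV r, ∃ c : Fin r → ℝ, ∑ a, c a • e a = W := fun W =>
    Submodule.mem_span_range_iff_exists_fun ℝ |>.1 <| by
      rw [hli.span_eq_top_of_card_eq_finrank' (by simp)]
      trivial
  obtain ⟨c, rfl⟩ := hspan Y
  have h : ∀ a, G (∑ b, c b • e b) (e a) = c a := fun a => by
    simp [map_sum, he]
  simp only [h]
  simp [map_sum, mul_comm]

/-! ## Curve flows -/

section Flow

variable {n m p r : ℕ} {V : Type*} [TopologicalSpace V] [ChartedSpace (UV n m) V]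

/-- The coframe, the metric and the connection are smooth, and the connection is metric. -/
structure DPart.IsMetricCompatible (P : DPart n m r V) : Prop where
  coframe_smooth : ∀ c ∈ atlas (UV n m) V, ContDiffOn ℝ ∞ (P.coframe c) c.target
  metric_smooth : ∀ c ∈ atlas (UV n m) V, ContDiffOn ℝ ∞ (P.metric c) c.target
  conn_smooth : ∀ c ∈ atlas (UV n m) V, ContDiffOn ℝ ∞ (P.conn c) c.target
  symm : ∀ c ∈ atlas (UV n m) V, ∀ u ∈ c.target, ∀ X Y, P.metric c u X Y = P.metric c u Y X
  compat : ∀ c ∈ atlas (UV n m) V, ∀ u ∈ c.target, ∀ (w : UV n m) (Y Z : EV r),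
    fderiv ℝ (fun u' => P.metric c u' Y Z) u w
      = P.metric c u (P.conn c u w Y) Z + P.metric c u Y (P.conn c u w Z)

theorem isMetricCompatible_hPart {M : NManifold n m V} (D : MetricDConnection M) :
    (hPart D).IsMetricCompatible where
  coframe_smooth _ _ := contDiffOn_const
  metric_smooth := M.g_smooth
  conn_smooth := D.Γh_smooth
  symm := M.g_symm
  compat := D.Dg

theorem isMetricCompatible_vPart {M : NManifold n m V} (D : MetricDConnection M) :
    (vPart D).IsMetricCompatible where
  coframe_smooth c hc := contDiffOn_const.add ((M.N_smooth c hc).clm_comp contDiffOn_const)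
  metric_smooth := M.h_smooth
  conn_smooth := D.Γv_smooth
  symm := M.h_symm
  compat := D.Dh

/-- The coefficients `⟨D_w e_a, e_b⟩` of the connection in the frame. -/
noncomputable def DPart.frameConn (P : DPart n m r V) (γ : ℝ × ℝ → V)
    (e : Fin r → (s : ℝ × ℝ) → TangentSpace 𝓘(ℝ, UV n m) (γ s)) (c : Chart n m V) (w : ℝ × ℝ)
    (a b : Fin r) (s : ℝ × ℝ) : ℝ :=
  P.metric c (c (γ s)) (P.covDeriv γ c (P.frame γ e c a) s w) (P.frame γ e c b s)

variable {P : DPart n m (p + 1) V} {T : Set ℝ} {γ : ℝ × ℝ → V}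
  {e : Fin (p + 1) → (s : ℝ × ℝ) → TangentSpace 𝓘(ℝ, UV n m) (γ s)} {c : Chart n m V}

namespace IsAdaptedFlow

theorem isOpen_domain (hf : IsAdaptedFlow P T γ e) (hT : IsOpen T) (c : Chart n m V) :
    IsOpen ((T ×ˢ univ) ∩ γ ⁻¹' c.source) :=
  hf.flow_smooth.continuousOn.isOpen_inter_preimage (hT.prod isOpen_univ) c.open_source

theorem contDiffAt_coord [IsManifold 𝓘(ℝ, UV n m) ∞ V] (hf : IsAdaptedFlow P T γ e)
    (hT : IsOpen T) (hc : c ∈ atlas (UV n m) V) {s : ℝ × ℝ}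
    (hs : s ∈ (T ×ˢ univ) ∩ γ ⁻¹' c.source) : ContDiffAt ℝ ∞ (c ∘ γ) s := by
  have h1 : ContMDiffOn 𝓘(ℝ, UV n m) 𝓘(ℝ, UV n m) ∞ c c.source :=
    contMDiffOn_of_mem_maximalAtlas (IsManifold.subset_maximalAtlas hc)
  have h2 := h1.comp (hf.flow_smooth.mono (inter_subset_left (t := γ ⁻¹' c.source)))
    inter_subset_right
  exact (contMDiffOn_iff_contDiffOn.1 h2).contDiffAt ((hf.isOpen_domain hT c).mem_nhds hs)

theorem contDiffAt_frame (hf : IsAdaptedFlow P T γ e)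
    (hT : IsOpen T) (hc : c ∈ atlas (UV n m) V) {s : ℝ × ℝ}
    (hs : s ∈ (T ×ˢ univ) ∩ γ ⁻¹' c.source) (a : Fin (p + 1)) :
    ContDiffAt ℝ ∞ (P.frame γ e c a) s :=
  (hf.frame_smooth c hc a).contDiffAt ((hf.isOpen_domain hT c).mem_nhds hs)

theorem metric_eq_sum (hf : IsAdaptedFlow P T γ e) (hc : c ∈ atlas (UV n m) V) {s : ℝ × ℝ}
    (hs : s ∈ (T ×ˢ univ) ∩ γ ⁻¹' c.source) (A B : EV (p + 1)) :
    P.metric c (c (γ s)) A B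
    = ∑ a, P.metric c (c (γ s)) A (P.frame γ e c a s) * P.metric c (c (γ s)) B (P.frame γ e c a s) :=
  apply_eq_sum_of_orthonormal (hf.orthonormal c hc s hs.1.1 hs.2) A B

theorem metric_curvature (hf : IsAdaptedFlow P T γ e) (hc : c ∈ atlas (UV n m) V) {s : ℝ × ℝ}
    (hs : s ∈ (T ×ˢ univ) ∩ γ ⁻¹' c.source) {R : ℝ} (hR : ConstCurvatureAlong P T γ R) (a b : Fin (p + 1)) :
    P.metric c (c (γ s)) (P.curvature c (c (γ s)) (fderiv ℝ (c ∘ γ) s (0, 1))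
          (fderiv ℝ (c ∘ γ) s (1, 0)) (P.frame γ e c a s)) (P.frame γ e c b s)
      = R * (P.metric c (c (γ s)) (P.vel γ c s (1, 0)) (P.frame γ e c a s) * (if 0 = b then 1 else 0)
        - (if 0 = a then 1 else 0)
          * P.metric c (c (γ s)) (P.vel γ c s (1, 0)) (P.frame γ e c b s)) := by
  rw [hR c hc s hs.1.1 hs.2, ← hf.tangent c hc s hs.1.1 hs.2]
  simp only [map_smul, map_sub, smul_apply, sub_apply,
    smul_eq_mul, hf.orthonormal c hc s hs.1.1 hs.2]

end IsAdaptedFlow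

namespace DPart.IsMetricCompatible

theorem contDiffAt_conn (hP : P.IsMetricCompatible) (hc : c ∈ atlas (UV n m) V) {x : V}
    (hx : x ∈ c.source) : ContDiffAt ℝ ∞ (P.conn c) (c x) :=
  (hP.conn_smooth c hc).contDiffAt (c.open_target.mem_nhds (c.map_source hx))

theorem contDiffAt_metric (hP : P.IsMetricCompatible) (hc : c ∈ atlas (UV n m) V) {x : V}
    (hx : x ∈ c.source) : ContDiffAt ℝ ∞ (P.metric c) (c x) :=
  (hP.metric_smooth c hc).contDiffAt (c.open_target.mem_nhds (c.map_source hx))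

theorem contDiffAt_coframe (hP : P.IsMetricCompatible) (hc : c ∈ atlas (UV n m) V) {x : V}
    (hx : x ∈ c.source) : ContDiffAt ℝ ∞ (P.coframe c) (c x) :=
  (hP.coframe_smooth c hc).contDiffAt (c.open_target.mem_nhds (c.map_source hx))

variable [IsManifold 𝓘(ℝ, UV n m) ∞ V] (hP : P.IsMetricCompatible) (hf : IsAdaptedFlow P T γ e) (hT : IsOpen T)
  (hc : c ∈ atlas (UV n m) V) {s : ℝ × ℝ} (hs : s ∈ (T ×ˢ univ) ∩ γ ⁻¹' c.source)

include hP hf hT hc hs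

theorem contDiffAt_covDeriv (a : Fin (p + 1)) (w : ℝ × ℝ) :
    ContDiffAt ℝ ∞ (fun s => P.covDeriv γ c (P.frame γ e c a) s w) s :=
  contDiffAt_covDer (u := c ∘ γ) (hP.contDiffAt_conn hc hs.2) (hf.contDiffAt_coord hT hc hs)
    (hf.contDiffAt_frame hT hc hs a) w

theorem contDiffAt_vel (w : ℝ × ℝ) : ContDiffAt ℝ ∞ (fun s => P.vel γ c s w) s :=
  ((hP.contDiffAt_coframe hc hs.2).comp (f := c ∘ γ) s (hf.contDiffAt_coord hT hc hs)).clm_apply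
    ((hf.contDiffAt_coord hT hc hs).fderiv_apply_const w)

/-- Product rule for the metric along the flow. -/
theorem fderiv_metric_apply {A B : ℝ × ℝ → EV (p + 1)} (hA : ContDiffAt ℝ ∞ A s)
    (hB : ContDiffAt ℝ ∞ B s) (w : ℝ × ℝ) :
    fderiv ℝ (fun s => P.metric c (c (γ s)) (A s) (B s)) s w
      = P.metric c (c (γ s)) (P.covDeriv γ c A s w) (B s)
        + P.metric c (c (γ s)) (A s) (P.covDeriv γ c B s w) :=
  fderiv_metric (u := c ∘ γ) (Γ := P.conn c) ((hP.contDiffAt_metric hc hs.2).differentiableAt (by simp))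
    ((hf.contDiffAt_coord hT hc hs).differentiableAt (by simp)) (hA.differentiableAt (by simp))
    (hB.differentiableAt (by simp)) (hP.compat c hc _ (c.map_source hs.2)) w

theorem contDiffAt_frameConn (w : ℝ × ℝ) (a b : Fin (p + 1)) :
    ContDiffAt ℝ ∞ (P.frameConn γ e c w a b) s :=
  _root_.contDiffAt_metric (u := c ∘ γ) (hP.contDiffAt_metric hc hs.2)
    (hf.contDiffAt_coord hT hc hs) (hP.contDiffAt_covDeriv hf hT hc hs a w)
    (hf.contDiffAt_frame hT hc hs b)

theorem contDiffAt_velComp (w : ℝ × ℝ) (a : Fin (p + 1)) :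
    ContDiffAt ℝ ∞ (fun s => P.metric c (c (γ s)) (P.vel γ c s w) (P.frame γ e c a s)) s :=
  _root_.contDiffAt_metric (u := c ∘ γ) (hP.contDiffAt_metric hc hs.2)
    (hf.contDiffAt_coord hT hc hs) (hP.contDiffAt_vel hf hT hc hs w)
    (hf.contDiffAt_frame hT hc hs a)

/-- The Gram matrix of the frame is constant along the flow; the product rule for the metric does
the rest. -/
theorem frameConn_skew (w : ℝ × ℝ) (a b : Fin (p + 1)) :
    P.frameConn γ e c w b a s = -P.frameConn γ e c w a b s := by
  have h := hP.fderiv_metric_apply hf hT hc hs (hf.contDiffAt_frame hT hc hs a)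
    (hf.contDiffAt_frame hT hc hs b) w
  have h0 : (fun s => P.metric c (c (γ s)) (P.frame γ e c a s) (P.frame γ e c b s))
      =ᶠ[𝓝 s] fun _ => if a = b then 1 else 0 := by
    filter_upwards [(hf.isOpen_domain hT c).mem_nhds hs] with s hs
    exact hf.orthonormal c hc s hs.1.1 hs.2 a b
  rw [h0.fderiv_eq, hP.symm c hc _ (c.map_source hs.2) (P.frame γ e c a s)] at h
  simp only [fderiv_fun_const, Pi.zero_apply, zero_apply] at h
  simp only [DPart.frameConn]
  linarith

/-- First structure equation: the torsion-free condition in the frame. -/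
theorem fderiv_velComp (htor : TorsionFreeAlong P T γ) (a : Fin (p + 1)) :
    fderiv ℝ (fun s => P.metric c (c (γ s)) (P.vel γ c s (1, 0)) (P.frame γ e c a s)) s (0, 1)
      = P.frameConn γ e c (1, 0) 0 a s
        + ∑ b, P.metric c (c (γ s)) (P.vel γ c s (1, 0)) (P.frame γ e c b s)
          * P.frameConn γ e c (0, 1) a b s := by
  rw [hP.fderiv_metric_apply hf hT hc hs (hP.contDiffAt_vel hf hT hc hs (1, 0))
    (hf.contDiffAt_frame hT hc hs a)]
  have h1 := covDer_coframe_sub (Γ := P.conn c) (θ := P.coframe c) (u := c ∘ γ)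
    ((hP.contDiffAt_coframe hc hs.2).differentiableAt (by simp)) (hf.contDiffAt_coord hT hc hs)
    (0, 1) (1, 0)
  -- Vanishing torsion means D_X Y = D_Y X, and X is the frame vector e₀ near s, not only at s.
  have h2 : P.covDeriv γ c (fun s => P.vel γ c s (1, 0)) s (0, 1)
      - P.covDeriv γ c (fun s => P.vel γ c s (0, 1)) s (1, 0) = 0 :=
    h1.trans (htor c hc s hs.1.1 hs.2)
  have h3 : (fun s => P.vel γ c s (0, 1)) =ᶠ[𝓝 s] P.frame γ e c 0 := by
    filter_upwards [(hf.isOpen_domain hT c).mem_nhds hs] with s hs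
    exact (hf.tangent c hc s hs.1.1 hs.2).symm
  have h4 : P.covDeriv γ c (fun s => P.vel γ c s (0, 1)) s (1, 0)
      = P.covDeriv γ c (P.frame γ e c 0) s (1, 0) := by
    simp only [DPart.covDeriv, h3.fderiv_eq, h3.eq_of_nhds]
  rw [sub_eq_zero.1 h2, h4]
  congr 1
  exact hf.metric_eq_sum hc hs _ _

/-- Second structure equation: the curvature in the frame. -/
theorem fderiv_frameConn_sub (a b : Fin (p + 1)) :
    fderiv ℝ (P.frameConn γ e c (1, 0) a b) s (0, 1)
        - fderiv ℝ (P.frameConn γ e c (0, 1) a b) s (1, 0)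
      = P.metric c (c (γ s)) (P.curvature c (c (γ s)) (fderiv ℝ (c ∘ γ) s (0, 1))
          (fderiv ℝ (c ∘ γ) s (1, 0)) (P.frame γ e c a s)) (P.frame γ e c b s)
        + ∑ d, (P.frameConn γ e c (1, 0) a d s * P.frameConn γ e c (0, 1) b d s
          - P.frameConn γ e c (0, 1) a d s * P.frameConn γ e c (1, 0) b d s) := by
  -- The product rule leaves ⟨D_w e_a, D_w' e_b⟩, which is expanded in the orthonormal frame.
  have h1 : ∀ w w' : ℝ × ℝ, fderiv ℝ (P.frameConn γ e c w a b) s w'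
      = P.metric c (c (γ s)) (P.covDeriv γ c (fun s => P.covDeriv γ c (P.frame γ e c a) s w) s w')
          (P.frame γ e c b s)
        + ∑ d, P.frameConn γ e c w a d s * P.frameConn γ e c w' b d s := fun w w' =>
    (hP.fderiv_metric_apply hf hT hc hs (hP.contDiffAt_covDeriv hf hT hc hs a w)
      (hf.contDiffAt_frame hT hc hs b) w').trans
      (congrArg _ (hf.metric_eq_sum hc hs _ _))
  have h2 : P.covDeriv γ c (fun s => P.covDeriv γ c (P.frame γ e c a) s (1, 0)) s (0, 1)
      - P.covDeriv γ c (fun s => P.covDeriv γ c (P.frame γ e c a) s (0, 1)) s (1, 0)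
      = P.curvature c (c (γ s)) (fderiv ℝ (c ∘ γ) s (0, 1))
          (fderiv ℝ (c ∘ γ) s (1, 0)) (P.frame γ e c a s) :=
    covDer_covDer_sub (u := c ∘ γ) ((hP.contDiffAt_conn hc hs.2).differentiableAt (by simp))
      (hf.contDiffAt_coord hT hc hs) (hf.contDiffAt_frame hT hc hs a) (0, 1) (1, 0)
  rw [h1, h1, ← h2, map_sub, sub_apply, Finset.sum_sub_distrib]
  ring

end DPart.IsMetricCompatible

end Flow

/-! ### From the structure equations to the Hamiltonian form of the flows -/

section FlowEquations

variable {n m p : ℕ} {V : Type*} [TopologicalSpace V] [ChartedSpace (UV n m) V]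
  {P : DPart n m (p + 1) V} {T : Set ℝ} {γ : ℝ × ℝ → V}
  {e : Fin (p + 1) → (s : ℝ × ℝ) → TangentSpace 𝓘(ℝ, UV n m) (γ s)} {σ R : ℝ} {W : FlowVars p}

theorem hasDerivAt_snd_slice {f : ℝ × ℝ → ℝ} {τ l : ℝ} (hf : ContDiffAt ℝ ∞ f (τ, l)) :
    HasDerivAt (fun l => f (τ, l)) (fderiv ℝ f (τ, l) (0, 1)) l :=
  HasFDerivAt.comp_hasDerivAt (l := f) l (hf.differentiableAt (by simp)).hasFDerivAt
    ((hasDerivAt_const l τ).prodMk (hasDerivAt_id l))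

theorem hasDerivAt_fst_slice {f : ℝ × ℝ → ℝ} {τ l : ℝ} (hf : ContDiffAt ℝ ∞ f (τ, l)) :
    HasDerivAt (fun τ => f (τ, l)) (fderiv ℝ f (τ, l) (1, 0)) τ :=
  HasFDerivAt.comp_hasDerivAt (l := f) τ (hf.differentiableAt (by simp)).hasFDerivAt
    ((hasDerivAt_id τ).prodMk (hasDerivAt_const τ l))

/-- The Cartan structure equations of a curve flow, in terms of its flow variables. -/
structure FlowStructureEqs (σ R : ℝ) (W : FlowVars p) (τ l : ℝ) : Prop where
  deriv_ePar : HasDerivAt (fun l => W.ePar τ l) (σ * inner ℝ (W.v τ l) (W.ePerp τ l)) l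
  deriv_ePerp : ∀ i, HasDerivAt (fun l => W.ePerp τ l i)
    (σ * W.varpi τ l i - σ * W.ePar τ l * W.v τ l i) l
  deriv_Theta : ∀ i j, HasDerivAt (fun l => W.Theta τ l i j) (-wedge (W.v τ) (W.varpi τ) i j l) l
  differentiable_v : ∀ i, DifferentiableAt ℝ (fun l => W.v τ l i) l
  differentiable_varpi : ∀ i, DifferentiableAt ℝ (fun l => W.varpi τ l i) l
  deriv_v : ∀ j, HasDerivAt (fun τ => W.v τ l j)
    (deriv (fun l => W.varpi τ l j) l - ∑ i, W.v τ l i * W.Theta τ l i j + σ * R * W.ePerp τ l j) τ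

/-- The equations are local, so one chart around γ(τ, l) suffices. The flow variables are entries of
the connection matrices and components of Y, and the equations are the corresponding entries of the
two structure equations. -/
theorem IsFlowVars.structureEqs [IsManifold 𝓘(ℝ, UV n m) ∞ V] (hW : IsFlowVars P T γ e σ W)
    (hP : P.IsMetricCompatible) (hf : IsAdaptedFlow P T γ e) (hT : IsOpen T)
    (hσ : σ = 1 ∨ σ = -1) (htor : TorsionFreeAlong P T γ) (hR : ConstCurvatureAlong P T γ R)
    {τ : ℝ} (hτ : τ ∈ T) (l : ℝ) : FlowStructureEqs σ R W τ l := by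
  have hσ2 : σ * σ = 1 := by rcases hσ with rfl | rfl <;> norm_num
  set c : Chart n m V := chartAt (UV n m) (γ (τ, l)) with hcdef
  have hc : c ∈ atlas (UV n m) V := chart_mem_atlas _ _
  have hs : (τ, l) ∈ (T ×ˢ univ) ∩ γ ⁻¹' c.source :=
    ⟨⟨hτ, mem_univ _⟩, mem_chart_source (UV n m) (γ (τ, l))⟩
  have hU := (hf.isOpen_domain hT c).mem_nhds hs
  have ev : ∀ i, (fun s : ℝ × ℝ => W.v s.1 s.2 i)
      =ᶠ[𝓝 (τ, l)] fun s => σ * P.frameConn γ e c (0, 1) 0 i.succ s := fun i => by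
    filter_upwards [hU] with s hs
    exact hW.v_eq c hc s.1 hs.1.1 s.2 hs.2 i
  have eϖ : ∀ i, (fun s : ℝ × ℝ => W.varpi s.1 s.2 i)
      =ᶠ[𝓝 (τ, l)] fun s => σ * P.frameConn γ e c (1, 0) 0 i.succ s := fun i => by
    filter_upwards [hU] with s hs
    exact hW.varpi_eq c hc s.1 hs.1.1 s.2 hs.2 i
  have eΘ : ∀ i j, (fun s : ℝ × ℝ => W.Theta s.1 s.2 i j)
      =ᶠ[𝓝 (τ, l)] P.frameConn γ e c (1, 0) i.succ j.succ := fun i j => by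
    filter_upwards [hU] with s hs
    exact hW.Theta_eq c hc s.1 hs.1.1 s.2 hs.2 i j
  have eperp : ∀ i : Fin p, (fun s : ℝ × ℝ => W.ePerp s.1 s.2 i) =ᶠ[𝓝 (τ, l)]
      fun s => P.metric c (c (γ s)) (P.vel γ c s (1, 0)) (P.frame γ e c i.succ s) := fun i => by
    filter_upwards [hU] with s hs
    exact hW.ePerp_eq c hc s.1 hs.1.1 s.2 hs.2 i
  have epar : (fun s : ℝ × ℝ => W.ePar s.1 s.2) =ᶠ[𝓝 (τ, l)]
      fun s => P.metric c (c (γ s)) (P.vel γ c s (1, 0)) (P.frame γ e c 0 s) := by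
    filter_upwards [hU] with s hs
    exact hW.ePar_eq c hc s.1 hs.1.1 s.2 hs.2
  -- Parallelism in the normal bundle is needed on a neighbourhood, since the τ-derivative of this
  -- entry occurs in the equation for Θ.
  have eflat : ∀ i j : Fin p, P.frameConn γ e c (0, 1) i.succ j.succ =ᶠ[𝓝 (τ, l)] fun _ => 0 :=
    fun i j => by
    filter_upwards [hU] with s hs
    exact hf.parallel c hc s hs.1.1 hs.2 i j
  have cA : ∀ w a b, ContDiffAt ℝ ∞ (P.frameConn γ e c w a b) (τ, l) :=
    hP.contDiffAt_frameConn hf hT hc hs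
  have cv : ∀ i, ContDiffAt ℝ ∞ (fun s : ℝ × ℝ => W.v s.1 s.2 i) (τ, l) := fun i =>
    (contDiffAt_const.mul (cA _ _ _)).congr_of_eventuallyEq (ev i)
  have cϖ : ∀ i, ContDiffAt ℝ ∞ (fun s : ℝ × ℝ => W.varpi s.1 s.2 i) (τ, l) := fun i =>
    (contDiffAt_const.mul (cA _ _ _)).congr_of_eventuallyEq (eϖ i)
  have cΘ : ∀ i j, ContDiffAt ℝ ∞ (fun s : ℝ × ℝ => W.Theta s.1 s.2 i j) (τ, l) := fun i j =>
    (cA _ _ _).congr_of_eventuallyEq (eΘ i j)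
  have cperp : ∀ i, ContDiffAt ℝ ∞ (fun s : ℝ × ℝ => W.ePerp s.1 s.2 i) (τ, l) := fun i =>
    (hP.contDiffAt_velComp hf hT hc hs (1, 0) i.succ).congr_of_eventuallyEq (eperp i)
  have cpar : ContDiffAt ℝ ∞ (fun s : ℝ × ℝ => W.ePar s.1 s.2) (τ, l) :=
    (hP.contDiffAt_velComp hf hT hc hs (1, 0) 0).congr_of_eventuallyEq epar
  have vA : ∀ i : Fin p, P.frameConn γ e c (0, 1) 0 i.succ (τ, l) = σ * W.v τ l i := fun i => by
    have h : W.v τ l i = σ * _ := (ev i).eq_of_nhds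
    rw [h, ← mul_assoc, hσ2, one_mul]
  have ϖA : ∀ i : Fin p, P.frameConn γ e c (1, 0) 0 i.succ (τ, l) = σ * W.varpi τ l i := fun i => by
    have h : W.varpi τ l i = σ * _ := (eϖ i).eq_of_nhds
    rw [h, ← mul_assoc, hσ2, one_mul]
  have ΘA : ∀ i j : Fin p, P.frameConn γ e c (1, 0) i.succ j.succ (τ, l) = W.Theta τ l i j :=
    fun i j => (eΘ i j).eq_of_nhds.symm
  have flatA : ∀ i j : Fin p, P.frameConn γ e c (0, 1) i.succ j.succ (τ, l) = 0 :=
    fun i j => (eflat i j).eq_of_nhds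
  have perpA : ∀ i : Fin p, P.metric c (c (γ (τ, l))) (P.vel γ c (τ, l) (1, 0))
      (P.frame γ e c i.succ (τ, l)) = W.ePerp τ l i := fun i => (eperp i).eq_of_nhds.symm
  have parA : P.metric c (c (γ (τ, l))) (P.vel γ c (τ, l) (1, 0))
      (P.frame γ e c 0 (τ, l)) = W.ePar τ l := epar.eq_of_nhds.symm
  have skew : ∀ w a b, P.frameConn γ e c w b a (τ, l) = -P.frameConn γ e c w a b (τ, l) :=
    hP.frameConn_skew hf hT hc hs
  have zeroA : ∀ w, P.frameConn γ e c w 0 0 (τ, l) = 0 := fun w => by linarith [skew w 0 0]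
  have s0 : ∀ w (i : Fin p), P.frameConn γ e c w i.succ 0 (τ, l)
      = -P.frameConn γ e c w 0 i.succ (τ, l) := fun w i => skew w 0 i.succ
  have ne0 : ∀ i : Fin p, ¬ (0 : Fin (p + 1)) = i.succ := fun i h => Fin.succ_ne_zero i h.symm
  constructor
  · refine (hasDerivAt_snd_slice cpar).congr_deriv ?_
    rw [epar.fderiv_eq, hP.fderiv_velComp hf hT hc hs htor, Fin.sum_univ_succ]
    simp only [zeroA, vA, perpA, PiLp.inner_apply, RCLike.inner_apply, conj_trivial, Finset.mul_sum]
    rw [mul_zero, zero_add, zero_add]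
    exact Finset.sum_congr rfl fun i _ => by ring
  · intro i
    refine (hasDerivAt_snd_slice (cperp i)).congr_deriv ?_
    rw [(eperp i).fderiv_eq, hP.fderiv_velComp hf hT hc hs htor, Fin.sum_univ_succ]
    simp only [s0, vA, ϖA, flatA, parA, mul_zero, Finset.sum_const_zero]
    ring
  · intro i j
    refine (hasDerivAt_snd_slice (cΘ i j)).congr_deriv ?_
    -- The constant-curvature term has no normal-normal entries because X = e₀; R therefore enters
    -- only the equation for v.
    have h := hP.fderiv_frameConn_sub hf hT hc hs i.succ j.succ
    rw [(eflat i j).fderiv_eq, hf.metric_curvature hc hs hR, Fin.sum_univ_succ] at h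
    simp only [s0, vA, ϖA, flatA, if_neg (ne0 _), mul_zero, zero_mul, sub_zero,
      Finset.sum_const_zero, fderiv_fun_const, Pi.zero_apply, zero_apply] at h
    rw [(eΘ i j).fderiv_eq, h]
    simp only [wedge]
    linear_combination (W.varpi τ l i * W.v τ l j - W.v τ l i * W.varpi τ l j) * hσ2
  · exact fun i => (hasDerivAt_snd_slice (cv i)).differentiableAt
  · exact fun i => (hasDerivAt_snd_slice (cϖ i)).differentiableAt
  · intro j
    refine (hasDerivAt_fst_slice (cv j)).congr_deriv ?_
    rw [(hasDerivAt_snd_slice (cϖ j)).deriv, (ev j).fderiv_eq, (eϖ j).fderiv_eq,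
      fderiv_const_mul ((cA _ _ _).differentiableAt (by simp)),
      fderiv_const_mul ((cA _ _ _).differentiableAt (by simp))]
    have h := hP.fderiv_frameConn_sub hf hT hc hs 0 j.succ
    rw [hf.metric_curvature hc hs hR, Fin.sum_univ_succ] at h
    simp only [zeroA, s0, vA, ΘA, flatA, perpA, if_neg (ne0 _), mul_zero, zero_mul, sub_zero,
      zero_sub, if_true, one_mul, zero_add] at h
    have hsum : ∑ k, -(σ * W.v τ l k * W.Theta τ l j k) = σ * ∑ k, W.v τ l k * W.Theta τ l k j := by
      rw [Finset.mul_sum]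
      refine Finset.sum_congr rfl fun k _ => ?_
      have := skew (1, 0) j.succ k.succ
      rw [ΘA, ΘA] at this
      rw [this]
      ring
    rw [hsum] at h
    simp only [smul_apply, smul_eq_mul]
    linear_combination (-σ) * h - (∑ k, W.v τ l k * W.Theta τ l k j) * hσ2

theorem flow_equations [IsManifold 𝓘(ℝ, UV n m) ∞ V] (hP : P.IsMetricCompatible) (hT : IsOpen T)
    (hσ : σ = 1 ∨ σ = -1) (hf : IsAdaptedFlow P T γ e) (hW : IsFlowVars P T γ e σ W)
    (htor : TorsionFreeAlong P T γ) (hR : ConstCurvatureAlong P T γ R) (hN : IsNormalized T W)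
    (τ : ℝ) (hτ : τ ∈ T) (l : ℝ) :
    W.varpi τ l = σ • opJ (W.v τ) (W.ePerp τ) l ∧
      HasDerivAt (fun τ' => W.v τ' l)
        (opH (W.v τ) (W.varpi τ) l + (σ * R) • W.ePerp τ l) τ ∧
      HasDerivAt (fun τ' => W.v τ' l)
        (σ • opR (W.v τ) (W.ePerp τ) l + (σ * R) • W.ePerp τ l) τ := by
  have hσ2 : σ * σ = 1 := by rcases hσ with rfl | rfl <;> norm_num
  have hS := fun l => hW.structureEqs hP hf hT hσ htor hR hτ l
  have dv : Differentiable ℝ (W.v τ) := differentiable_euclidean.2 fun i l => (hS l).differentiable_v i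
  have dϖ : Differentiable ℝ (W.varpi τ) :=
    differentiable_euclidean.2 fun i l => (hS l).differentiable_varpi i
  have dperp : ∀ l, HasDerivAt (W.ePerp τ) (σ • W.varpi τ l - (σ * W.ePar τ l) • W.v τ l) l :=
    fun l => hasDerivAt_euclidean fun i => (hS l).deriv_ePerp i
  have hcperp : Continuous (W.ePerp τ) :=
    continuous_iff_continuousAt.2 fun l => (dperp l).continuousAt
  -- The normalization of the limits fixes the constant of integration; the same argument gives Θ
  -- below.
  have hpar : ∀ l, Dinv (fun y => inner ℝ (W.v τ y) (W.ePerp τ y)) l = σ * W.ePar τ l := by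
    refine fun l => (congrFun (eq_Dinv (F := fun l => σ * W.ePar τ l) (hN.integrable_dot τ hτ)
      (dv.continuous.inner hcperp) (fun l => ?_) ?_) l).symm
    · refine ((hS l).deriv_ePar.const_mul σ).congr_deriv ?_
      rw [← mul_assoc, hσ2, one_mul]
    · simpa [mul_add] using (hN.ePar_limits τ hτ).const_mul σ
  have hΘ : ∀ i j l, Dinv (wedge (W.v τ) (W.varpi τ) i j) l = -W.Theta τ l i j := by
    refine fun i j l => (congrFun (eq_Dinv (F := fun l => -W.Theta τ l i j)
      (hN.integrable_wedge τ hτ i j) ?_ (fun l => ?_) ?_) l).symm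
    · have cc : ∀ {f : ℝ → EV p}, Differentiable ℝ f → ∀ i, Continuous fun l => f l i :=
        fun hf i => (EuclideanSpace.proj i : EV p →L[ℝ] ℝ).continuous.comp hf.continuous
      exact ((cc dv i).mul (cc dϖ j)).sub ((cc dϖ i).mul (cc dv j))
    · exact ((hS l).deriv_Theta i j).fun_neg.congr_deriv (neg_neg _)
    · simpa [add_comm] using (hN.Theta_limits τ hτ i j).neg
  have hJ : ∀ l, W.varpi τ l = σ • opJ (W.v τ) (W.ePerp τ) l := fun l => by
    rw [opJ, (dperp l).deriv, hpar, sub_add_cancel, smul_smul, hσ2, one_smul]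
  have hH : HasDerivAt (fun τ' => W.v τ' l)
      (opH (W.v τ) (W.varpi τ) l + (σ * R) • W.ePerp τ l) τ := by
    refine hasDerivAt_euclidean fun j => ((hS l).deriv_v j).congr_deriv ?_
    have hd : deriv (fun l => W.varpi τ l j) l = deriv (W.varpi τ) l j :=
      ((EuclideanSpace.proj j : EV p →L[ℝ] ℝ).hasFDerivAt.comp_hasDerivAt l
        (dϖ l).hasDerivAt).deriv
    rw [hd, opH_eq]
    simp [hΘ, Finset.sum_neg_distrib, sub_eq_add_neg]
  refine ⟨hJ l, hH, ?_⟩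
  have hJ' : opJ (W.v τ) (W.ePerp τ) = fun l => σ • W.varpi τ l := by
    ext1 l
    rw [hJ l, smul_smul, hσ2, one_smul]
  -- H is homogeneous in its argument, so the two factors σ multiply to 1.
  have hR' : σ • opR (W.v τ) (W.ePerp τ) l = opH (W.v τ) (W.varpi τ) l := by
    rw [opR, hJ', opH_smul σ _ dϖ, smul_smul, hσ2, one_smul]
  rw [hR']
  exact hH

end FlowEquations

/-! ### Assembly for the horizontal and the vertical variables -/

theorem mainTheorem2 (p q : ℕ) :
    -- the operators, for the horizontal variable in `ℝ^(n-1)`, `n = p + 1`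
    (IsSymplecticOperator (opJ (k := p)) ∧ IsOrthInvariant (opJ (k := p)) ∧
      IsHamiltonianOperator (opH (k := p)) WedgeExact ∧ IsOrthInvariant (opH (k := p)) ∧
      IsHereditary (opR (k := p)) (fun v f => WedgeExact v (opJ v f))) ∧
    -- the operators, for the vertical variable in `ℝ^(m-1)`, `m = q + 1`
    (IsSymplecticOperator (opJ (k := q)) ∧ IsOrthInvariant (opJ (k := q)) ∧
      IsHamiltonianOperator (opH (k := q)) WedgeExact ∧ IsOrthInvariant (opH (k := q)) ∧
      IsHereditary (opR (k := q)) (fun v f => WedgeExact v (opJ v f))) ∧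
    -- the flow equations
    ∀ {V : Type*} [TopologicalSpace V] [ChartedSpace (UV (p + 1) (q + 1)) V]
      [IsManifold 𝓘(ℝ, UV (p + 1) (q + 1)) ∞ V]
      (M : NManifold (p + 1) (q + 1) V) (D : MetricDConnection M)
      (T : Set ℝ) (_ : IsOpen T) (γ : ℝ × ℝ → V) (σ : ℝ) (_ : σ = 1 ∨ σ = -1),
      -- h-flows
      (∀ (R : ℝ) (e : Fin (p + 1) → (s : ℝ × ℝ) → TangentSpace 𝓘(ℝ, UV (p + 1) (q + 1)) (γ s))
          (W : FlowVars p),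
        IsAdaptedFlow (hPart D) T γ e → IsFlowVars (hPart D) T γ e σ W →
        TorsionFreeAlong (hPart D) T γ → ConstCurvatureAlong (hPart D) T γ R →
        IsNormalized T W →
        ∀ τ ∈ T, ∀ l : ℝ,
          W.varpi τ l = σ • opJ (W.v τ) (W.ePerp τ) l ∧
          HasDerivAt (fun τ' => W.v τ' l)
            (opH (W.v τ) (W.varpi τ) l + (σ * R) • W.ePerp τ l) τ ∧
          HasDerivAt (fun τ' => W.v τ' l)
            (σ • opR (W.v τ) (W.ePerp τ) l + (σ * R) • W.ePerp τ l) τ) ∧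
      -- v-flows
      (∀ (S : ℝ) (e : Fin (q + 1) → (s : ℝ × ℝ) → TangentSpace 𝓘(ℝ, UV (p + 1) (q + 1)) (γ s))
          (W : FlowVars q),
        IsAdaptedFlow (vPart D) T γ e → IsFlowVars (vPart D) T γ e σ W →
        TorsionFreeAlong (vPart D) T γ → ConstCurvatureAlong (vPart D) T γ S →
        IsNormalized T W →
        ∀ τ ∈ T, ∀ l : ℝ,
          W.varpi τ l = σ • opJ (W.v τ) (W.ePerp τ) l ∧
          HasDerivAt (fun τ' => W.v τ' l)
            (opH (W.v τ) (W.varpi τ) l + (σ * S) • W.ePerp τ l) τ ∧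
          HasDerivAt (fun τ' => W.v τ' l)
            (σ • opR (W.v τ) (W.ePerp τ) l + (σ * S) • W.ePerp τ l) τ) :=
  ⟨⟨isSymplecticOperator_opJ, isOrthInvariant_opJ, isHamiltonianOperator_opH, isOrthInvariant_opH,
      isHereditary_opR⟩,
    ⟨isSymplecticOperator_opJ, isOrthInvariant_opJ, isHamiltonianOperator_opH, isOrthInvariant_opH,
      isHereditary_opR⟩,
    fun _ D _ hT _ _ hσ =>
      ⟨fun _ _ _ hf hW htor hR hN => flow_equations (isMetricCompatible_hPart D) hT hσ hf hW htor hR hN,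
        fun _ _ _ hf hW htor hR hN =>
          flow_equations (isMetricCompatible_vPart D) hT hσ hf hW htor hR hN⟩⟩
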